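/- Let $(\Omega,\mathcal F,(\mathcal F_t)_{t\ge0},\mathbb P)$ be a filtered probability space satisfying the usual conditions with $\mathcal F_0$ $\mathbb P$-trivial. Processes are identified up to indistinguishability; $\mathscr P_+$ and $\mathscr P_{++}$ are the sets of non-negative and of positive progressively measurable processes. Let $b>0$, $\delta\in\mathbb R$, $R,S\in(0,\infty)\setminus\{1\}$ with $R\ne S$, and put $\theta=\frac{1-R}{1-S}$, $\rho=\frac{S-R}{1-R}=\frac{\theta-1}{\theta}$; assume $\theta>0$. For $Y\in\mathscr P_+$ let $\mathbb O(Y)$ be the set of $X\in\mathscr P_+$ for which there are constants $k,K\in(0,\infty)$ with $0\le kY\le X\le KY$. Let $\hat L^\theta_{++}$ be the set of $\Lambda\in\mathscr P_{++}$ with $\mathbb E\int_0^\infty\Lambda_s^\theta\,ds<\infty$ such that $\Lambda^\theta\in\mathbb O(I^\Lambda)$, where $I^\Lambda$ is the càdlàg version of $t\mapsto\mathbb E[\int_t^\infty\Lambda_s^\theta\,ds\mid\mathcal F_t]$. Let $h_{EZ}(u,w)=uw^\rho$ for $u,w\in(0,\infty)$, extended to $[0,\infty]^2$ by $h_{EZ}(u,w)=w^\rho$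 for $u\in(0,\infty)$, $w\in\{0,\infty\}$ and $h_{EZ}(u,w)=u$ for $u\in\{0,\infty\}$ (with $0^\rho=\infty$ and $\infty^\rho=0$ if $\rho<0$), and let $\mathbb I(h_{EZ},U)$ be the set of $W\in\mathscr P_+$ with $\mathbb E\int_0^\infty h_{EZ}(U_s,W_s)\,ds<\infty$. (1) Let $\varepsilon\ge0$, $\Lambda\in\hat L^\theta_{++}$ and $U\in\mathbb O(\Lambda)$. Then $\mathbb O(\Lambda^\theta)\subseteq\mathbb I(h_{EZ},U)$, and the operator $$F^\varepsilon_{U,\Lambda}(W)_t=\mathbb E\Big[\int_t^\infty(U_sW_s^\rho+\varepsilon\Lambda_s^\theta)\,ds\,\Big|\,\mathcal F_t\Big],\qquad t\ge0,$$ where the càdlàg version of the right-hand side is taken, has a fixed point $W\in\mathbb O(\Lambda^\theta)$. It is unique in $\mathbb O(\Lambda^\theta)$ up to indistinguishability, and it has càdlàg paths. (2) Let $C\in\mathscr P_{++}$ satisfy $\mathbb E\int_0^\infty e^{-\delta\theta s}C_s^{1-R}\,ds<\infty$, put $J_t=\mathbb E[\int_t^\infty e^{-\delta\theta s}C_s^{1-R}\,ds\mid\mathcal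 F_t]$, and suppose that there are constants $0<k<K<\infty$ such that, for every $t\ge0$, $kJ_t\le e^{-\delta\theta t}C_t^{1-R}\le KJ_t$ almost surely. Consider the Epstein–Zin aggregator $$g_{EZ}(t,c,v)=b\,e^{-\delta t}\,\frac{c^{1-S}}{1-S}\,\big((1-R)v\big)^\rho,\qquad c\ge 0,\ v\in\mathbb V:=(1-R)[0,\infty),$$ where the boundary values are those of $\frac1{1-R}h_{EZ}\big(b\theta e^{-\delta t}c^{1-S},(1-R)v\big)$. A utility process for $(g_{EZ},C)$ is a progressively measurable, $\mathbb V$-valued process $V$ with càdlàg paths such that $\mathbb E\int_0^\infty|g_{EZ}(s,C_s,V_s)|\,ds<\infty$ and, for every $t\ge0$, $V_t=\mathbb E[\int_t^\infty g_{EZ}(s,C_s,V_s)\,ds\mid\mathcal F_t]$ almost surely. Then there is a utility process $V$ for $(g_{EZ},C)$ with the property that $(1-R)V_t/J_t$ is bounded above and below by strictly positive constants not depending on $t$ (almost surely, for each $t\ge 0$), and it is unique, up to indistinguishability, among the utility processes with this property. -/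

import Mathlib

open MeasureTheory Filter Topology Set
open scoped NNReal ENNReal

namespace EZ

variable {Ω : Type*} {m : MeasurableSpace Ω}

/-- The usual conditions: right-continuity, and every `P`-null set (that is, every set of outer
measure zero) belongs to `𝓕 0`. -/
structure UsualConditions (𝓕 : Filtration ℝ≥0 m) (P : Measure Ω) : Prop where
  rightCont : 𝓕.IsRightContinuous
  complete : ∀ A : Set Ω, P A = 0 → MeasurableSet[𝓕 0] A

/-- `X` and `Y` are indistinguishable. -/
def Indistinguishable (P : Measure Ω) (X Y : ℝ≥0 → Ω → ℝ) : Prop :=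
  ∀ᵐ ω ∂P, ∀ t, X t ω = Y t ω

/-- A càdlàg path: right-continuous with (finite) left limits. -/
def IsCadlag (x : ℝ≥0 → ℝ) : Prop :=
  ∀ t, ContinuousWithinAt x (Ici t) t ∧ ∃ l, Tendsto x (𝓝[<] t) (𝓝 l)

/-- Non-negative progressively measurable processes. Processes are identified up to
indistinguishability, so the sign condition is required off a null set. -/
def ProgNonneg (𝓕 : Filtration ℝ≥0 m) (P : Measure Ω) : Set (ℝ≥0 → Ω → ℝ) :=
  {X | IsStronglyProgressive 𝓕 X ∧ ∀ᵐ ω ∂P, ∀ t, 0 ≤ X t ω}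

/-- Lebesgue measure on `[0, ∞)`. -/
noncomputable def leb : Measure ℝ≥0 := (volume : Measure ℝ).comap (fun t : ℝ≥0 => (t : ℝ))

/-- Positive progressively measurable processes. -/
def ProgPos (𝓕 : Filtration ℝ≥0 m) (P : Measure Ω) : Set (ℝ≥0 → Ω → ℝ) :=
  {X | IsStronglyProgressive 𝓕 X ∧ ∀ᵐ ω ∂P, ∀ t, 0 < X t ω}

/-- The process `Λ ^ θ`. -/
noncomputable def powProc (Λ : ℝ≥0 → Ω → ℝ) (θ : ℝ) : ℝ≥0 → Ω → ℝ :=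
  fun t ω => Λ t ω ^ θ

/-- The set of processes with the same order as `Y`: there are constants `k, K ∈ (0, ∞)` with
`0 ≤ k Y ≤ X ≤ K Y`, up to indistinguishability. -/
def OrderClass (𝓕 : Filtration ℝ≥0 m) (P : Measure Ω) (Y : ℝ≥0 → Ω → ℝ) :
    Set (ℝ≥0 → Ω → ℝ) :=
  {X | X ∈ ProgNonneg 𝓕 P ∧ ∃ k K : ℝ, 0 < k ∧ 0 < K ∧
    ∀ᵐ ω ∂P, ∀ t, 0 ≤ k * Y t ω ∧ k * Y t ω ≤ X t ω ∧ X t ω ≤ K * Y t ω}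

/-- `t ↦ E[∫_t^∞ f_s ds | 𝓕_t]`, where the conditional expectation is any version. -/
noncomputable def condTail (𝓕 : Filtration ℝ≥0 m) (P : Measure Ω) (f : ℝ≥0 → Ω → ℝ) :
    ℝ≥0 → Ω → ℝ :=
  fun t => P[fun ω => ∫ s in Ioi t, f s ω ∂leb | 𝓕 t]

/-- `X` is a càdlàg adapted version of the process `Y`. -/
structure IsCadlagVersion (𝓕 : Filtration ℝ≥0 m) (P : Measure Ω)
    (Y X : ℝ≥0 → Ω → ℝ) : Prop where
  adapted : StronglyAdapted 𝓕 X
  cadlag : ∀ᵐ ω ∂P, IsCadlag fun t => X t ω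
  version : ∀ t, X t =ᵐ[P] Y t

/-- `Λ` is positive and progressively measurable with `E[∫_0^∞ Λ_s^θ ds] < ∞`. -/
def LTheta (𝓕 : Filtration ℝ≥0 m) (P : Measure Ω) (θ : ℝ) : Set (ℝ≥0 → Ω → ℝ) :=
  {Λ | Λ ∈ ProgPos 𝓕 P ∧ ∫⁻ ω, (∫⁻ s, ENNReal.ofReal (Λ s ω ^ θ) ∂leb) ∂P < ∞}

/-- The `Λ` in `LTheta` such that `Λ ^ θ` has the same order as the càdlàg process
`t ↦ E[∫_t^∞ Λ_s^θ ds | 𝓕_t]`. -/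
def LThetaHat (𝓕 : Filtration ℝ≥0 m) (P : Measure Ω) (θ : ℝ) : Set (ℝ≥0 → Ω → ℝ) :=
  {Λ | Λ ∈ LTheta 𝓕 P θ ∧ ∃ I : ℝ≥0 → Ω → ℝ,
    IsCadlagVersion 𝓕 P (condTail 𝓕 P (powProc Λ θ)) I ∧ powProc Λ θ ∈ OrderClass 𝓕 P I}

/-- The aggregator `(u, w) ↦ u w ^ ρ`, extended to `[0, ∞]²`. The power on `ℝ≥0∞` follows the
convention `0 ^ ρ = ∞` and `∞ ^ ρ = 0` for `ρ < 0`. -/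
noncomputable def hEZ (ρ : ℝ) (u w : ℝ≥0∞) : ℝ≥0∞ :=
  open Classical in
  if u = 0 ∨ u = ∞ then u else if w = 0 ∨ w = ∞ then w ^ ρ else u * w ^ ρ

/-- Progressively measurable `W` with `E[∫_0^∞ h_EZ(U_s, W_s) ds] < ∞`. -/
def IntegrableFor (𝓕 : Filtration ℝ≥0 m) (P : Measure Ω) (ρ : ℝ) (U : ℝ≥0 → Ω → ℝ) :
    Set (ℝ≥0 → Ω → ℝ) :=
  {W | W ∈ ProgNonneg 𝓕 P ∧
    ∫⁻ ω, (∫⁻ s, hEZ ρ (ENNReal.ofReal (U s ω)) (ENNReal.ofReal (W s ω)) ∂leb) ∂P < ∞}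

/-- `W` is a fixed point of the perturbed operator sending `W` to the càdlàg version of
`t ↦ E[∫_t^∞ (U_s W_s^ρ + ε Λ_s^θ) ds | 𝓕_t]`. -/
def IsFixedPoint (𝓕 : Filtration ℝ≥0 m) (P : Measure Ω) (θ ρ ε : ℝ)
    (U Λ W : ℝ≥0 → Ω → ℝ) : Prop :=
  IsCadlagVersion 𝓕 P
    (condTail 𝓕 P fun s ω => U s ω * W s ω ^ ρ + ε * Λ s ω ^ θ) W

/-- `V` is a utility process for the aggregator `g` (with domain `𝕍` in its last variable) and the
consumption stream `C`: it is progressively measurable, `𝕍`-valued, càdlàg, satisfies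
`E[∫_0^∞ |g(s, C_s, V_s)| ds] < ∞`, and `V_t = E[∫_t^∞ g(s, C_s, V_s) ds | 𝓕_t]` for all `t`. -/
structure IsUtilityProcess (𝓕 : Filtration ℝ≥0 m) (P : Measure Ω) (𝕍 : Set ℝ)
    (g : ℝ≥0 → ℝ → ℝ → EReal) (C V : ℝ≥0 → Ω → ℝ) : Prop where
  prog : IsStronglyProgressive 𝓕 V
  valued : ∀ᵐ ω ∂P, ∀ t, V t ω ∈ 𝕍
  integrable : ∫⁻ ω, (∫⁻ s, (g s (C s ω) (V s ω)).abs ∂leb) ∂P < ∞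
  cadlag : ∀ᵐ ω ∂P, IsCadlag fun t => V t ω
  eq : ∀ t, V t =ᵐ[P] condTail 𝓕 P (fun s ω => (g s (C s ω) (V s ω)).toReal) t

/-- The domain `(1 - R) ℝ₊` of the Epstein–Zin aggregator in its last variable. -/
def domEZ (R : ℝ) : Set ℝ := {v | ∃ x : ℝ, 0 ≤ x ∧ v = (1 - R) * x}

/-- The Epstein–Zin aggregator `b e^{-δt} c^{1-S} / (1-S) * ((1-R)v)^ρ`, with `θ = (1-R)/(1-S)` and
`ρ = (S-R)/(1-R)`. It is written as `h_EZ(u, w) / (1-R)` with `u = b θ e^{-δt} c^{1-S}` and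
`w = (1-R) v`, which also fixes its (possibly infinite) values for `c = 0` or `v = 0`;
see `gEZ_of_pos`. -/
noncomputable def gEZ (b δ R S : ℝ) (t : ℝ≥0) (c v : ℝ) : EReal :=
  (((1 - R)⁻¹ : ℝ) : EReal) *
    (hEZ ((S - R) / (1 - R))
      (ENNReal.ofReal (b * ((1 - R) / (1 - S)) * Real.exp (-δ * t)) *
        ENNReal.ofReal c ^ (1 - S))
      (ENNReal.ofReal ((1 - R) * v)) : EReal)

/-- For positive `c` and `(1-R) v`, `gEZ` is given by the usual formula. -/
theorem gEZ_of_pos {b δ R S : ℝ} (hb : 0 < b) (hR : R ≠ 1)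
    (hθ : 0 < (1 - R) / (1 - S)) (t : ℝ≥0) {c v : ℝ} (hc : 0 < c) (hv : 0 < (1 - R) * v) :
    gEZ b δ R S t c v =
      ((b * Real.exp (-δ * t) * (c ^ (1 - S) / (1 - S)) *
        ((1 - R) * v) ^ ((S - R) / (1 - R)) : ℝ) : EReal) := by
  have hR' : (1 - R) ≠ 0 := sub_ne_zero.mpr hR.symm
  have ha : 0 < b * ((1 - R) / (1 - S)) * Real.exp (-δ * t) := by positivity
  have hp : 0 < c ^ (1 - S) := Real.rpow_pos_of_pos hc _
  have hw : 0 < ((1 - R) * v) ^ ((S - R) / (1 - R)) := Real.rpow_pos_of_pos hv _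
  unfold gEZ hEZ
  rw [ENNReal.ofReal_rpow_of_pos hc, ← ENNReal.ofReal_mul ha.le]
  have h1 : ENNReal.ofReal (b * ((1 - R) / (1 - S)) * Real.exp (-δ * t) * c ^ (1 - S)) ≠ 0 := by
    simpa using mul_pos ha hp
  have h2 : ENNReal.ofReal ((1 - R) * v) ≠ 0 := by simpa using hv
  rw [if_neg (by simp only [not_or]; exact ⟨h1, ENNReal.ofReal_ne_top⟩),
    if_neg (by simp only [not_or]; exact ⟨h2, ENNReal.ofReal_ne_top⟩),
    ENNReal.ofReal_rpow_of_pos hv, ← ENNReal.ofReal_mul (mul_pos ha hp).le,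
    EReal.coe_ennreal_ofReal, max_eq_left (mul_pos (mul_pos ha hp) hw).le, ← EReal.coe_mul]
  congr 1
  field_simp

end EZ

/-! Write `a = Λ ^ θ` and let `I` be the càdlàg version of its conditional tail integral. By
assumption `a` and `I` have the same order. Since `ρ = 1 - 1/θ` and `U` has the order of `Λ`, hence
of `I ^ (1/θ)`, the process `U * I ^ ρ` again has the order of `I`. So the operator preserves the
order class of `I`, and everything takes place in bands `lo * I ≤ W ≤ hi * I`.

For `0 ≤ ρ < 1` the operator is increasing and has elasticity at most `ρ`, so it contracts ratios.
For `ρ < 0` it is decreasing, and for `ρ ≤ -1` its elasticity need not be below one in absolute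
value. Discounting removes both obstacles: `W` is the tail of `f` if and only if `exp (-c t) W` is
the tail of `exp (-c s) (f + c W)` (`IsTail.discount`, `IsTail.of_discount`). On a band, `c` can be
chosen so large that `w ↦ U w ^ ρ + c w` is increasing (`driver_mono`), while its elasticity stays
below some `κ < 1` because `c w` is at most a multiple of `U w ^ ρ` there (`driver_elastic`). Hence
`W ≤ (1 + x) V` gives `1 + κ x` for the images (`Comparable.step_le`). Iteration yields uniqueness;
existence comes from the supremum of the iterates started at `lo * I`, in a band which the operator
preserves.

Càdlàg versions are built from the upcrossing and maximal inequalities along dyadic grids: a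
non-negative martingale has one-sided dyadic limits almost surely, and its right limits form a
càdlàg version under the usual conditions. A conditional tail is such a martingale minus an adapted
càdlàg integral.

The Epstein–Zin statement is the case `ε = 0`, `Λ = exp (-δ s) C ^ (1 - S)`, `U = b θ Λ`, `W = (1 -
R) V`. Its bounds hold only almost surely at each time. By Tonelli this suffices for all comparisons
of tails (`IsTail`), and càdlàg paths turn the resulting equalities into indistinguishability. -/

namespace EZ

variable {Ω : Type*} {m : MeasurableSpace Ω} {𝓕 : Filtration ℝ≥0 m} {P : Measure Ω}

/-! ### Lebesgue measure on the half-line -/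

theorem leb_apply (s : Set ℝ≥0) : leb s = volume ((fun t : ℝ≥0 => (t : ℝ)) '' s) :=
  (MeasurableEmbedding.subtype_coe measurableSet_Ici).comap_apply _ _

instance : SigmaFinite leb := by
  refine ⟨⟨⟨fun n : ℕ => Iic (n : ℝ≥0), fun _ => trivial, fun n => ?_, ?_⟩⟩⟩
  · rw [leb_apply]
    refine (measure_mono (t := Icc (0 : ℝ) n) ?_).trans_lt measure_Icc_lt_top
    rintro _ ⟨t, ht, rfl⟩
    exact ⟨t.2, by exact_mod_cast (show t ≤ n from ht)⟩
  · refine eq_univ_of_forall fun t => ?_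
    obtain ⟨n, hn⟩ := exists_nat_ge t
    exact mem_iUnion.2 ⟨n, hn⟩

/-! ### Dyadic approximation from the right -/

/-- The smallest multiple of `2⁻ⁿ` that is larger than `t`. -/
noncomputable def dyadicAbove (n : ℕ) (t : ℝ≥0) : ℝ≥0 := (⌊t * 2 ^ n⌋₊ + 1 : ℕ) / 2 ^ n

theorem lt_dyadicAbove (n : ℕ) (t : ℝ≥0) : t < dyadicAbove n t := by
  rw [dyadicAbove, lt_div_iff₀ (by positivity)]
  exact_mod_cast Nat.lt_floor_add_one (t * 2 ^ n)

theorem dyadicAbove_le (n : ℕ) (t : ℝ≥0) : dyadicAbove n t ≤ t + (1 / 2) ^ n := by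
  have h : (⌊t * 2 ^ n⌋₊ : ℝ≥0) ≤ t * 2 ^ n := Nat.floor_le (by positivity)
  rw [dyadicAbove, div_le_iff₀ (by positivity), add_mul, ← mul_pow]
  push_cast
  rw [one_div, inv_mul_cancel₀ two_ne_zero, one_pow]
  gcongr

theorem tendsto_dyadicAbove (t : ℝ≥0) :
    Tendsto (fun n => dyadicAbove n t) atTop (𝓝[>] t) := by
  refine tendsto_nhdsWithin_iff.2 ⟨?_, Eventually.of_forall fun n => lt_dyadicAbove n t⟩
  refine tendsto_of_tendsto_of_tendsto_of_le_of_le tendsto_const_nhds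
    (h := fun n => t + (1 / 2) ^ n) ?_ (fun n => (lt_dyadicAbove n t).le)
    (fun n => dyadicAbove_le n t)
  have h : Tendsto (fun n : ℕ => (1 / 2 : ℝ≥0) ^ n) atTop (𝓝 0) :=
    tendsto_pow_atTop_nhds_zero_of_lt_one zero_le (NNReal.half_lt_self one_ne_zero)
  simpa using h.const_add t

/-! ### Progressive and càdlàg processes -/

/-- Freezing time at `n` gives jointly measurable maps that agree with `f` at each point for large
`n`. -/
theorem measurable_uncurry_of_progressive {f : ℝ≥0 → Ω → ℝ} (h : IsStronglyProgressive 𝓕 f) :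
    Measurable (Function.uncurry f) := by
  have h1 : ∀ n : ℕ, Measurable fun p : ℝ≥0 × Ω => f (min p.1 n) p.2 := by
    intro n
    have h2 : Measurable[Subtype.instMeasurableSpace.prod m]
        fun p : Iic (n : ℝ≥0) × Ω => f p.1 p.2 :=
      (h n).measurable.mono (sup_le_sup le_rfl (MeasurableSpace.comap_mono (𝓕.le n))) le_rfl
    have h3 : Measurable fun p : ℝ≥0 × Ω =>
        ((⟨min p.1 n, mem_Iic.2 (min_le_right _ _)⟩ : Iic (n : ℝ≥0)), p.2) :=
      ((measurable_fst.min measurable_const).subtype_mk).prodMk measurable_snd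
    exact h2.comp h3
  refine measurable_of_tendsto_metrizable h1 (tendsto_pi_nhds.2 fun p => ?_)
  refine tendsto_const_nhds.congr' ?_
  obtain ⟨k, hk⟩ := exists_nat_ge p.1
  filter_upwards [eventually_ge_atTop k] with n hn
  rw [min_eq_left (hk.trans (by exact_mod_cast hn))]
  rfl

/-- Evaluating at the next dyadic time, capped at `i`, involves countably many random variables and
converges by right-continuity. The cap keeps every evaluation time in the range where `X t` is known
to be measurable, as progressive measurability requires. -/
theorem measurable_prod_of_continuousWithinAt_Ici {X : ℝ≥0 → Ω → ℝ} (i : ℝ≥0)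
    (h : ∀ t ≤ i, Measurable (X t)) (hc : ∀ ω t, ContinuousWithinAt (fun t => X t ω) (Ici t) t) :
    Measurable fun p : Iic i × Ω => X p.1 p.2 := by
  have h0 : ∀ (φ : ℝ≥0 → ℕ) (ψ : ℕ → ℝ≥0), Measurable φ →
      Measurable fun p : Iic i × Ω => X (min (ψ (φ p.1)) i) p.2 := by
    intro φ ψ hφ
    have hg : Measurable fun q : ℕ × Ω => X (min (ψ q.1) i) q.2 :=
      measurable_from_prod_countable_right fun k => h (min (ψ k) i) (min_le_right _ _)
    have hk : Measurable fun p : Iic i × Ω => (φ p.1, p.2) :=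
      (hφ.comp (measurable_subtype_coe.comp measurable_fst)).prodMk measurable_snd
    exact hg.comp hk
  have h1 : ∀ n : ℕ, Measurable fun p : Iic i × Ω => X (min (dyadicAbove n p.1) i) p.2 :=
    fun n => h0 (fun t => ⌊t * 2 ^ n⌋₊) (fun k => (k + 1 : ℕ) / 2 ^ n)
      (Nat.measurable_floor.comp (measurable_id.mul_const _))
  refine measurable_of_tendsto_metrizable h1 (tendsto_pi_nhds.2 fun p => ?_)
  refine ((hc p.2 p.1).tendsto).comp (tendsto_nhdsWithin_iff.2 ⟨?_, ?_⟩)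
  · have := ((tendsto_dyadicAbove p.1).mono_right nhdsWithin_le_nhds).min
      (tendsto_const_nhds (x := i))
    rwa [min_eq_left p.1.2] at this
  · exact Eventually.of_forall fun n => le_min (lt_dyadicAbove n _).le p.1.2

theorem isStronglyProgressive_of_isCadlag {X : ℝ≥0 → Ω → ℝ}
    (h : StronglyAdapted 𝓕 X) (hc : ∀ ω, IsCadlag fun t => X t ω) :
    IsStronglyProgressive 𝓕 X := by
  intro i
  exact (@measurable_prod_of_continuousWithinAt_Ici _ (𝓕 i) X i
    (fun t ht => (h t).measurable.mono (𝓕.mono ht) le_rfl) fun ω t => (hc ω t).1).stronglyMeasurable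

/-- A relation between càdlàg processes which is closed and holds almost surely at each time holds
almost surely at all times. -/
theorem ae_forall_of_forall_ae {X Y : ℝ≥0 → Ω → ℝ} (hX : ∀ᵐ ω ∂P, IsCadlag fun t => X t ω)
    (hY : ∀ᵐ ω ∂P, IsCadlag fun t => Y t ω) (h : ∀ t, ∀ᵐ ω ∂P, X t ω ≤ Y t ω) :
    ∀ᵐ ω ∂P, ∀ t, X t ω ≤ Y t ω := by
  have h1 : ∀ᵐ ω ∂P, ∀ p : ℕ × ℕ, X (p.2 / 2 ^ p.1) ω ≤ Y (p.2 / 2 ^ p.1) ω :=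
    ae_all_iff.2 fun p => h _
  filter_upwards [hX, hY, h1] with ω hx hy h1 t
  have ht : Tendsto (fun n => dyadicAbove n t) atTop (𝓝[≥] t) :=
    (tendsto_dyadicAbove t).mono_right (nhdsWithin_mono _ Ioi_subset_Ici_self)
  exact le_of_tendsto_of_tendsto' ((hx t).1.tendsto.comp ht) ((hy t).1.tendsto.comp ht)
    fun n => h1 (n, ⌊t * 2 ^ n⌋₊ + 1)

theorem indistinguishable_of_forall_ae {X Y : ℝ≥0 → Ω → ℝ}
    (hX : ∀ᵐ ω ∂P, IsCadlag fun t => X t ω) (hY : ∀ᵐ ω ∂P, IsCadlag fun t => Y t ω)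
    (h : ∀ t, X t =ᵐ[P] Y t) : Indistinguishable P X Y := by
  filter_upwards [ae_forall_of_forall_ae hX hY fun t => (h t).le,
    ae_forall_of_forall_ae hY hX fun t => (h t).symm.le] with ω h1 h2 t
  exact le_antisymm (h1 t) (h2 t)

theorem IsCadlag.comp_continuous₂ {x y : ℝ≥0 → ℝ} (hx : IsCadlag x) (hy : IsCadlag y)
    {φ : ℝ → ℝ → ℝ} (hφ : Continuous (Function.uncurry φ)) : IsCadlag fun t => φ (x t) (y t) := by
  intro t
  obtain ⟨hx1, l, hl⟩ := hx t
  obtain ⟨hy1, k, hk⟩ := hy t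
  exact ⟨hφ.continuousAt.comp_continuousWithinAt (f := fun t => (x t, y t)) (hx1.prodMk hy1), φ l k,
    (hφ.tendsto (l, k)).comp (hl.prodMk_nhds hk)⟩

theorem isCadlag_of_continuous {x : ℝ≥0 → ℝ} (hx : Continuous x) : IsCadlag x := fun t =>
  ⟨hx.continuousWithinAt, x t, hx.continuousAt.tendsto.mono_left nhdsWithin_le_nhds⟩

/-! ### Oscillations along the dyadic numbers -/

/-- The non-negative dyadic numbers. -/
def dyadics : Set ℝ≥0 := {q | ∃ n k : ℕ, q = k / 2 ^ n}

theorem dyadicAbove_mem (n : ℕ) (t : ℝ≥0) : dyadicAbove n t ∈ dyadics := ⟨n, _, rfl⟩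

/-- All fine enough grids contain a given dyadic number, so finitely many dyadic oscillations are
seen by a single discrete-time process. -/
theorem eventually_eq_div_of_mem_dyadics {q : ℝ≥0} (hq : q ∈ dyadics) :
    ∀ᶠ n : ℕ in atTop, ∃ j : ℕ, q = j / 2 ^ n := by
  obtain ⟨n₀, k, rfl⟩ := hq
  filter_upwards [eventually_ge_atTop n₀] with n hn
  refine ⟨k * 2 ^ (n - n₀), ?_⟩
  rw [div_eq_div_iff (by positivity) (by positivity)]
  push_cast
  rw [mul_assoc, ← pow_add, Nat.sub_add_cancel hn]

theorem tendsto_dyadicAbove_dyadics (t : ℝ≥0) :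
    Tendsto (fun n => dyadicAbove n t) atTop (𝓝[dyadics ∩ Ioi t] t) :=
  tendsto_nhdsWithin_iff.2 ⟨(tendsto_dyadicAbove t).mono_right nhdsWithin_le_nhds,
    Eventually.of_forall fun n => ⟨dyadicAbove_mem n t, lt_dyadicAbove n t⟩⟩

instance (t : ℝ≥0) : (𝓝[dyadics ∩ Ioi t] t).NeBot := (tendsto_dyadicAbove_dyadics t).neBot

/-- The path `x` oscillates from below `a` to above `b` at least `k` times along dyadic times in
the interval `[s, e]`. -/
inductive Osc (x : ℝ≥0 → ℝ) (a b : ℝ) : ℕ → ℝ≥0 → ℝ≥0 → Prop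
  | nil {s e : ℝ≥0} : s ≤ e → Osc x a b 0 s e
  | snoc {k : ℕ} {s u p q e : ℝ≥0} : Osc x a b k s u → u ≤ p → p ∈ dyadics → x p < a →
      p ≤ q → q ∈ dyadics → b < x q → q ≤ e → Osc x a b (k + 1) s e

/-- The restriction of a process to the multiples of `2⁻ⁿ`. -/
noncomputable def onGrid (M : ℝ≥0 → Ω → ℝ) (n : ℕ) : ℕ → Ω → ℝ := fun k => M (k / 2 ^ n)

/-- Crossing times are first hitting times, so each is at most the grid index of the corresponding
witness `p` or `q`. They are capped at the horizon `L`, whence the condition on `L`. -/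
theorem Osc.eventually_upperCrossingTime_le {M : ℝ≥0 → Ω → ℝ} {ω : Ω} {a b : ℝ} {k : ℕ}
    {s e : ℝ≥0} (h : Osc (fun t => M t ω) a b k s e) :
    ∀ᶠ n : ℕ in atTop, ∀ L : ℕ, e * 2 ^ n ≤ L →
      ((upperCrossingTime a b (onGrid M n) L k ω : ℕ) : ℝ≥0) ≤ e * 2 ^ n := by
  induction h with
  | nil h => exact Eventually.of_forall fun n L hL => by simp
  | @snoc k s u p q e h1 hup hp hpa hpq hq hqb hqe ih =>
    filter_upwards [ih, eventually_eq_div_of_mem_dyadics hp, eventually_eq_div_of_mem_dyadics hq]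
      with n hn ⟨i, hi⟩ ⟨j, hj⟩ L hL
    have h2 : (0 : ℝ≥0) < 2 ^ n := by positivity
    have hi' : (i : ℝ≥0) = p * 2 ^ n := by rw [hi, div_mul_cancel₀ _ h2.ne']
    have hj' : (j : ℝ≥0) = q * 2 ^ n := by rw [hj, div_mul_cancel₀ _ h2.ne']
    have hij : i ≤ j := by
      have : (i : ℝ≥0) ≤ j := by rw [hi', hj']; gcongr
      exact_mod_cast this
    have hjL : j ≤ L := by
      have : (j : ℝ≥0) ≤ L := by rw [hj']; exact le_trans (by gcongr) hL
      exact_mod_cast this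
    have hui : upperCrossingTime a b (onGrid M n) L k ω ≤ i := by
      have : ((upperCrossingTime a b (onGrid M n) L k ω : ℕ) : ℝ≥0) ≤ i := by
        rw [hi']
        refine (hn L (le_trans ?_ hL)).trans (by gcongr)
        gcongr
        exact hup.trans (hpq.trans hqe)
      exact_mod_cast this
    have hl : lowerCrossingTime a b (onGrid M n) L k ω ≤ i := by
      refine hittingBtwn_le_of_mem hui (hij.trans hjL) ?_
      simp only [onGrid, ← hi]
      exact hpa.le
    have hu : upperCrossingTime a b (onGrid M n) L (k + 1) ω ≤ j := by
      rw [upperCrossingTime_succ_eq]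
      refine hittingBtwn_le_of_mem (hl.trans hij) hjL ?_
      simp only [onGrid, ← hj]
      exact hqb.le
    calc ((upperCrossingTime a b (onGrid M n) L (k + 1) ω : ℕ) : ℝ≥0) ≤ j := by exact_mod_cast hu
      _ = q * 2 ^ n := hj'
      _ ≤ e * 2 ^ n := by gcongr

theorem Osc.eventually_le_upcrossingsBefore {M : ℝ≥0 → Ω → ℝ} {ω : Ω} {a b : ℝ} (hab : a < b)
    {k N : ℕ} {s e : ℝ≥0} (h : Osc (fun t => M t ω) a b k s e) (he : e ≤ N) :
    ∀ᶠ n : ℕ in atTop, k ≤ upcrossingsBefore a b (onGrid M n) (N * 2 ^ n + 1) ω := by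
  filter_upwards [h.eventually_upperCrossingTime_le] with n hn
  -- An upcrossing is counted only if it ends strictly before the horizon; the `+ 1` provides this
  -- strictness.
  refine le_csSup (upperCrossingTime_lt_bddAbove hab) ?_
  have h1 : e * 2 ^ n ≤ (N * 2 ^ n : ℕ) := by push_cast; gcongr
  have h2 := (hn (N * 2 ^ n + 1) (h1.trans (by push_cast; simp))).trans h1
  exact Nat.lt_succ_of_le (by exact_mod_cast h2)

/-- Oscillations are chosen backwards: the last one first, then the others inside `(t, p)`, so the
endpoint `e` varies in the induction. On the left of `t` the choice runs forwards. -/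
theorem exists_osc_right {x : ℝ≥0 → ℝ} {a b : ℝ} {t : ℝ≥0}
    (ha : ∃ᶠ s in 𝓝[dyadics ∩ Ioi t] t, x s < a) (hb : ∃ᶠ s in 𝓝[dyadics ∩ Ioi t] t, b < x s)
    (k : ℕ) {e : ℝ≥0} (he : t < e) : ∃ s, t < s ∧ Osc x a b k s e := by
  have key : ∀ e, t < e → ∀ᶠ s in 𝓝[dyadics ∩ Ioi t] t, (s ∈ dyadics ∧ t < s) ∧ s < e :=
    fun e he => (eventually_mem_nhdsWithin).and
      (eventually_nhdsWithin_of_eventually_nhds (eventually_lt_nhds he))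
  induction k generalizing e with
  | zero => exact ⟨e, he, .nil le_rfl⟩
  | succ k ih =>
    obtain ⟨q, hqb, ⟨hq, htq⟩, hqe⟩ := (hb.and_eventually (key e he)).exists
    obtain ⟨p, hpa, ⟨hp, htp⟩, hpq⟩ := (ha.and_eventually (key q htq)).exists
    obtain ⟨s, hs, ho⟩ := ih htp
    exact ⟨s, hs, .snoc ho le_rfl hp hpa hpq.le hq hqb hqe.le⟩

theorem exists_osc_left {x : ℝ≥0 → ℝ} {a b : ℝ} {t : ℝ≥0}
    (ha : ∃ᶠ s in 𝓝[dyadics ∩ Iio t] t, x s < a) (hb : ∃ᶠ s in 𝓝[dyadics ∩ Iio t] t, b < x s)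
    (k : ℕ) {s : ℝ≥0} (hs : s < t) : ∃ e, e < t ∧ Osc x a b k s e := by
  have key : ∀ s, s < t → ∀ᶠ p in 𝓝[dyadics ∩ Iio t] t, (p ∈ dyadics ∧ p < t) ∧ s < p :=
    fun e he => (eventually_mem_nhdsWithin).and
      (eventually_nhdsWithin_of_eventually_nhds (eventually_gt_nhds he))
  induction k with
  | zero => exact ⟨s, hs, .nil le_rfl⟩
  | succ k ih =>
    obtain ⟨u, hu, ho⟩ := ih
    obtain ⟨p, hpa, ⟨hp, htp⟩, hup⟩ := (ha.and_eventually (key u hu)).exists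
    obtain ⟨q, hqb, ⟨hq, htq⟩, hpq⟩ := (hb.and_eventually (key p htp)).exists
    exact ⟨q, htq, .snoc ho hup.le hp hpa hpq.le hq hqb le_rfl⟩

/-- The path `x` has one-sided limits along the dyadic numbers. -/
def HasDyadicLimits (x : ℝ≥0 → ℝ) : Prop :=
  ∀ t, (∃ r, Tendsto x (𝓝[dyadics ∩ Ioi t] t) (𝓝 r)) ∧
    ∃ l, Tendsto x (𝓝[dyadics ∩ Iio t] t) (𝓝 l)

/-- Without a limit at `t`, a bounded path crosses some rational interval arbitrarily often near
`t`, and all fine grids see these crossings. A bound on upcrossings along infinitely many grids is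
therefore enough for a contradiction. -/
theorem hasDyadicLimits_of_upcrossings {M : ℝ≥0 → Ω → ℝ} {ω : Ω}
    (hU : ∀ (N : ℕ) (a b : ℚ), a < b → ∃ K : ℕ, ∃ᶠ n : ℕ in atTop,
      upcrossingsBefore (a : ℝ) b (onGrid M n) (N * 2 ^ n + 1) ω ≤ K)
    (hB : ∀ N : ℕ, ∃ K : ℝ, ∀ n j : ℕ, j ≤ N * 2 ^ n → |M (j / 2 ^ n) ω| ≤ K) :
    HasDyadicLimits fun t => M t ω := by
  have hosc : ∀ (N : ℕ) (a b : ℚ), a < b →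
      ∃ k, ∀ s e : ℝ≥0, e ≤ N → ¬ Osc (fun t => M t ω) a b k s e := by
    intro N a b hab
    obtain ⟨K, hK⟩ := hU N a b hab
    refine ⟨K + 1, fun s e he ho => ?_⟩
    obtain ⟨n, hn, hn'⟩ := (hK.and_eventually
      (ho.eventually_le_upcrossingsBefore (by exact_mod_cast hab) he)).exists
    omega
  have hbdd : ∀ (N : ℕ), ∃ K : ℝ, ∀ q ∈ dyadics, q ≤ N → |M q ω| ≤ K := by
    intro N
    obtain ⟨K, hK⟩ := hB N
    refine ⟨K, ?_⟩
    rintro q ⟨n, k, rfl⟩ hq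
    refine hK n k ?_
    rw [div_le_iff₀ (by positivity)] at hq
    exact_mod_cast hq
  have hlim : ∀ (t : ℝ≥0) (S : Set ℝ≥0), (∀ a b : ℚ, a < b →
      ¬ ((∃ᶠ s in 𝓝[dyadics ∩ S] t, M s ω < a) ∧ ∃ᶠ s in 𝓝[dyadics ∩ S] t, (b : ℝ) < M s ω)) →
      ∃ r, Tendsto (fun s => M s ω) (𝓝[dyadics ∩ S] t) (𝓝 r) := by
    intro t S h
    obtain ⟨N, hN⟩ := exists_nat_gt t
    obtain ⟨K, hK⟩ := hbdd N
    have hev : ∀ᶠ s in 𝓝[dyadics ∩ S] t, |M s ω| ≤ K := by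
      filter_upwards [eventually_mem_nhdsWithin,
        eventually_nhdsWithin_of_eventually_nhds (eventually_lt_nhds hN)] with s hs hs'
      exact hK s hs.1 hs'.le
    refine tendsto_of_no_upcrossings (s := range ((↑) : ℚ → ℝ)) Rat.denseRange_cast ?_
      ⟨K, eventually_map.2 (hev.mono fun s hs => (abs_le.1 hs).2)⟩
      ⟨-K, eventually_map.2 (hev.mono fun s hs => (abs_le.1 hs).1)⟩
    rintro _ ⟨a, rfl⟩ _ ⟨b, rfl⟩ hab
    exact h a b (by exact_mod_cast hab)
  intro t
  obtain ⟨N, hN⟩ := exists_nat_gt t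
  refine ⟨hlim t (Ioi t) fun a b hab => ?_, hlim t (Iio t) fun a b hab => ?_⟩
  · rintro ⟨h1, h2⟩
    obtain ⟨k, hk⟩ := hosc N a b hab
    obtain ⟨s, hs, ho⟩ := exists_osc_right h1 h2 k hN
    exact hk s N le_rfl ho
  · rintro ⟨h1, h2⟩
    obtain ⟨k, hk⟩ := hosc N a b hab
    have ht : 0 < t := by
      obtain ⟨s, _, hs⟩ := (h1.and_eventually eventually_mem_nhdsWithin).exists
      exact zero_le.trans_lt hs.2
    obtain ⟨e, he, ho⟩ := exists_osc_left h1 h2 k ht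
    exact hk 0 e (he.trans hN).le ho

/-- If `x` maps the dyadic points of an open interval into a closed set, then all right limits at
points of the interval lie in that set. Closed neighbourhoods form a basis, so `r` inherits the
one-sided limits of `x`. -/
theorem isCadlag_of_tendsto_dyadics {x r : ℝ≥0 → ℝ} (hx : HasDyadicLimits x)
    (hr : ∀ t, Tendsto x (𝓝[dyadics ∩ Ioi t] t) (𝓝 (r t))) : IsCadlag r := by
  have hmem : ∀ {V : Set ℝ} {s : ℝ≥0}, IsClosed V →
      (∀ᶠ q in 𝓝[>] s, q ∈ dyadics → x q ∈ V) → r s ∈ V := by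
    intro V s hV h
    refine hV.mem_of_tendsto (hr s) ?_
    rw [inter_comm, nhdsWithin_inter']
    exact mem_inf_principal.2 h
  intro t
  constructor
  · rw [← continuousWithinAt_Ioi_iff_Ici]
    refine (closed_nhds_basis (r t)).ge_iff.2 ?_
    rintro V ⟨hV, hVc⟩
    have h1 : ∀ᶠ q in 𝓝[>] t, q ∈ dyadics → x q ∈ V := by
      have := (hr t) hV
      rw [mem_map, inter_comm, nhdsWithin_inter'] at this
      exact mem_inf_principal.1 this
    obtain ⟨u, hu, hsub⟩ := mem_nhdsGT_iff_exists_Ioo_subset.1 h1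
    rw [mem_map]
    filter_upwards [Ioo_mem_nhdsGT hu] with s hs
    refine hmem hVc ?_
    filter_upwards [Ioo_mem_nhdsGT hs.2] with q hq
    exact hsub ⟨hs.1.trans hq.1, hq.2⟩
  · obtain ⟨l, hl⟩ := (hx t).2
    refine ⟨l, ?_⟩
    rcases eq_or_ne t 0 with rfl | ht
    · simp
    refine (closed_nhds_basis l).ge_iff.2 ?_
    rintro V ⟨hV, hVc⟩
    have h1 : ∀ᶠ q in 𝓝[<] t, q ∈ dyadics → x q ∈ V := by
      have := hl hV
      rw [mem_map, inter_comm, nhdsWithin_inter'] at this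
      exact mem_inf_principal.1 this
    obtain ⟨u, hu, hsub⟩ := (mem_nhdsLT_iff_exists_Ioo_subset' (pos_iff_ne_zero.2 ht)).1 h1
    rw [mem_map]
    filter_upwards [Ioo_mem_nhdsLT hu] with s hs
    refine hmem hVc ?_
    filter_upwards [Ioo_mem_nhdsGT hs.2] with q hq
    exact hsub ⟨hs.1.trans hq.1, hq.2⟩

/-! ### Càdlàg versions of non-negative martingales -/

/-- The filtration `𝓕` along the multiples of `2⁻ⁿ`. -/
noncomputable def gridFiltration (𝓕 : Filtration ℝ≥0 m) (n : ℕ) : Filtration ℕ m where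
  seq k := 𝓕 (k / 2 ^ n)
  mono' _ _ h := 𝓕.mono (by gcongr)
  le' _ := 𝓕.le _

theorem martingale_onGrid {M : ℝ≥0 → Ω → ℝ} (hM : Martingale M 𝓕 P) (n : ℕ) :
    Martingale (onGrid M n) (gridFiltration 𝓕 n) P :=
  ⟨fun k => hM.1 (k / 2 ^ n), fun i j h => hM.2 _ _ (by gcongr)⟩

theorem martingale_integral_eq [IsProbabilityMeasure P] {M : ℝ≥0 → Ω → ℝ}
    (hM : Martingale M 𝓕 P) (t : ℝ≥0) : ∫ ω, M t ω ∂P = ∫ ω, M 0 ω ∂P := by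
  have h := hM.setIntegral_eq (zero_le (a := t)) (MeasurableSet.univ (m := 𝓕 0))
  simpa using h.symm

/-- Doob's inequality bounds the expected number of upcrossings by `C`, independently of the grid.
Fatou's lemma then makes the liminf over grids almost surely finite, which is a bound along
infinitely many grids. -/
theorem ae_frequently_upcrossingsBefore_le [IsProbabilityMeasure P] {M : ℝ≥0 → Ω → ℝ}
    (hM : Martingale M 𝓕 P) (hM0 : ∀ t ω, 0 ≤ M t ω) {a b : ℝ} (hab : a < b) (N : ℕ) :
    ∀ᵐ ω ∂P, ∃ K : ℕ, ∃ᶠ n : ℕ in atTop,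
      upcrossingsBefore a b (onGrid M n) (N * 2 ^ n + 1) ω ≤ K := by
  set C : ℝ := (∫ ω, M 0 ω ∂P + |a|) / (b - a)
  have hb : 0 < b - a := sub_pos.2 hab
  have hmeas : ∀ n : ℕ, Measurable (upcrossingsBefore a b (onGrid M n) (N * 2 ^ n + 1)) :=
    fun n => (martingale_onGrid hM n).stronglyAdapted.measurable_upcrossingsBefore hab
  have hle : ∀ n : ℕ, ∫⁻ ω, (upcrossingsBefore a b (onGrid M n) (N * 2 ^ n + 1) ω : ℝ≥0∞) ∂P
      ≤ ENNReal.ofReal C := by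
    intro n
    have h1 := (martingale_onGrid hM n).submartingale.mul_integral_upcrossingsBefore_le_integral_pos_part
      a b (N * 2 ^ n + 1)
    have h2 : ∫ ω, (onGrid M n (N * 2 ^ n + 1) ω - a)⁺ ∂P ≤ ∫ ω, M 0 ω ∂P + |a| := by
      rw [← martingale_integral_eq hM ((N * 2 ^ n + 1 : ℕ) / 2 ^ n)]
      have h3 : Integrable (M ((N * 2 ^ n + 1 : ℕ) / 2 ^ n)) P := hM.integrable _
      calc ∫ ω, (onGrid M n (N * 2 ^ n + 1) ω - a)⁺ ∂P
          ≤ ∫ ω, (M ((N * 2 ^ n + 1 : ℕ) / 2 ^ n) ω + |a|) ∂P := by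
            refine integral_mono_of_nonneg (Eventually.of_forall fun ω => posPart_nonneg _)
              (h3.add (integrable_const _)) (Eventually.of_forall fun ω => ?_)
            have h5 := hM0 ((N * 2 ^ n + 1 : ℕ) / 2 ^ n) ω
            have h6 := neg_abs_le a
            simp only [onGrid]
            exact sup_le (by linarith) (by positivity)
        _ = _ := by
            rw [integral_add h3 (integrable_const _)]
            simp
    have h4 : ∫ ω, (upcrossingsBefore a b (onGrid M n) (N * 2 ^ n + 1) ω : ℝ) ∂P ≤ C := by
      rw [le_div_iff₀ hb, mul_comm]
      exact h1.trans h2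
    rw [show ∫⁻ ω, (upcrossingsBefore a b (onGrid M n) (N * 2 ^ n + 1) ω : ℝ≥0∞) ∂P =
      ∫⁻ ω, ENNReal.ofReal (upcrossingsBefore a b (onGrid M n) (N * 2 ^ n + 1) ω : ℝ) ∂P by simp,
      ← ofReal_integral_eq_lintegral_ofReal
        ((martingale_onGrid hM n).stronglyAdapted.integrable_upcrossingsBefore hab)
        (Eventually.of_forall fun ω => Nat.cast_nonneg _)]
    exact ENNReal.ofReal_le_ofReal h4
  have hmeas' : ∀ n : ℕ, Measurable fun ω =>
      (upcrossingsBefore a b (onGrid M n) (N * 2 ^ n + 1) ω : ℝ≥0∞) :=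
    fun n => measurable_from_top.comp (hmeas n)
  have hfin : ∫⁻ ω, liminf (fun n : ℕ =>
      (upcrossingsBefore a b (onGrid M n) (N * 2 ^ n + 1) ω : ℝ≥0∞)) atTop ∂P ≠ ∞ := by
    refine ((lintegral_liminf_le hmeas').trans ?_).trans_lt (ENNReal.ofReal_lt_top (r := C)) |>.ne
    exact liminf_le_of_frequently_le' (Frequently.of_forall hle)
  filter_upwards [ae_lt_top (Measurable.liminf hmeas') hfin] with ω hω
  obtain ⟨K, hK⟩ := ENNReal.lt_iff_exists_nnreal_btwn.1 hω
  obtain ⟨k, hk⟩ := exists_nat_ge K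
  refine ⟨k, (frequently_lt_of_liminf_lt (by isBoundedDefault) hK.1).mono fun n hn => ?_⟩
  have h5 : (upcrossingsBefore a b (onGrid M n) (N * 2 ^ n + 1) ω : ℝ≥0∞) ≤ (k : ℝ≥0∞) :=
    hn.le.trans (by exact_mod_cast hk)
  exact_mod_cast h5

/-- The maximal inequality gives `K * P (B K n) ≤ E[M 0]` for all `n`. The grids are nested, so the
bound passes to the union over `n`, and the paths exceeding every level form a null set. -/
theorem ae_bounded_on_grids [IsProbabilityMeasure P] {M : ℝ≥0 → Ω → ℝ}
    (hM : Martingale M 𝓕 P) (hM0 : ∀ t ω, 0 ≤ M t ω) (N : ℕ) :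
    ∀ᵐ ω ∂P, ∃ K : ℝ, ∀ n j : ℕ, j ≤ N * 2 ^ n → |M (j / 2 ^ n) ω| ≤ K := by
  let B : ℕ → ℕ → Set Ω := fun K n => {ω | ∃ j : ℕ, j ≤ N * 2 ^ n ∧ (K : ℝ) ≤ M (j / 2 ^ n) ω}
  have hBmono : ∀ K, Monotone (B K) := by
    refine fun K => monotone_nat_of_le_succ fun n => ?_
    rintro ω ⟨j, hj, hjK⟩
    -- The grid point `j / 2 ^ n` has index `2 * j` on the next grid.
    refine ⟨2 * j, by rw [pow_succ]; linarith, ?_⟩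
    convert hjK using 2
    rw [div_eq_div_iff (by positivity) (by positivity), pow_succ]
    push_cast
    ring
  set C : ℝ≥0∞ := ENNReal.ofReal (∫ ω, M 0 ω ∂P)
  have hB : ∀ K n : ℕ, (K : ℝ≥0∞) * P (B K n) ≤ C := by
    intro K n
    have h1 := maximal_ineq (martingale_onGrid hM n).submartingale (fun k ω => hM0 _ ω) (ε := (K : ℝ≥0))
      (N * 2 ^ n)
    have h2 : B K n ⊆ {ω | ((K : ℝ≥0) : ℝ) ≤ (Finset.range (N * 2 ^ n + 1)).sup'
        Finset.nonempty_range_add_one fun k => onGrid M n k ω} := by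
      rintro ω ⟨j, hj, hjK⟩
      have h3 := Finset.le_sup' (fun k => onGrid M n k ω) (Finset.mem_range_succ_iff.2 hj)
      exact (show ((K : ℝ≥0) : ℝ) ≤ onGrid M n j ω by simpa [onGrid] using hjK).trans h3
    calc (K : ℝ≥0∞) * P (B K n) ≤ _ := mul_le_mul_right (measure_mono h2) _
      _ ≤ _ := by simpa using h1
      _ ≤ C := by
        refine ENNReal.ofReal_le_ofReal ?_
        rw [← martingale_integral_eq hM ((N * 2 ^ n : ℕ) / 2 ^ n)]
        exact setIntegral_le_integral (hM.integrable _) (Eventually.of_forall fun ω => hM0 _ ω)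
  have hB' : ∀ K : ℕ, (K : ℝ≥0∞) * P (⋃ n, B K n) ≤ C := by
    intro K
    rw [(hBmono K).measure_iUnion, ENNReal.mul_iSup]
    exact iSup_le (hB K)
  have hnull : P (⋂ K, ⋃ n, B K n) = 0 := by
    by_contra h
    have h3 : ∀ K : ℕ, (K : ℝ≥0∞) * P (⋂ K, ⋃ n, B K n) ≤ C := fun K =>
      (mul_le_mul_right (measure_mono (iInter_subset _ K)) _).trans (hB' K)
    obtain ⟨K, hK⟩ := ENNReal.exists_nat_mul_gt h (ENNReal.ofReal_ne_top (r := ∫ ω, M 0 ω ∂P))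
    exact absurd (h3 K) (not_le.2 hK)
  have : ∀ᵐ ω ∂P, ω ∉ ⋂ K, ⋃ n, B K n := measure_eq_zero_iff_ae_notMem.1 hnull
  filter_upwards [this] with ω hω
  simp only [mem_iInter, not_forall, mem_iUnion, not_exists] at hω
  obtain ⟨K, hK⟩ := hω
  refine ⟨K, fun n j hj => ?_⟩
  rw [abs_of_nonneg (hM0 _ ω)]
  by_contra h
  exact hK n ⟨j, hj, (not_le.1 h).le⟩

theorem ae_hasDyadicLimits [IsProbabilityMeasure P] {M : ℝ≥0 → Ω → ℝ}
    (hM : Martingale M 𝓕 P) (hM0 : ∀ t ω, 0 ≤ M t ω) :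
    ∀ᵐ ω ∂P, HasDyadicLimits fun t => M t ω := by
  have h1 : ∀ᵐ ω ∂P, ∀ (N : ℕ) (a b : ℚ), a < b → ∃ K : ℕ, ∃ᶠ n : ℕ in atTop,
      upcrossingsBefore (a : ℝ) b (onGrid M n) (N * 2 ^ n + 1) ω ≤ K := by
    refine ae_all_iff.2 fun N => ae_all_iff.2 fun a => ae_all_iff.2 fun b => ?_
    by_cases hab : a < b
    · filter_upwards [ae_frequently_upcrossingsBefore_le hM hM0
        (show (a : ℝ) < b by exact_mod_cast hab) N] with ω hω _ using hω
    · exact Eventually.of_forall fun ω h => absurd h hab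
  filter_upwards [h1, ae_all_iff.2 (ae_bounded_on_grids hM hM0)] with ω h2 h3
  exact hasDyadicLimits_of_upcrossings h2 h3

theorem UsualConditions.measurable_of_forall_gt (hU : UsualConditions 𝓕 P) {t : ℝ≥0}
    {X : Ω → ℝ} (h : ∀ s, t < s → Measurable[𝓕 s] X) : Measurable[𝓕 t] X := by
  have := hU.rightCont
  intro A hA
  refine Filtration.IsRightContinuous.measurableSet (𝓕 := 𝓕) ?_
  rw [Filtration.rightCont_eq]
  simp only [MeasurableSpace.measurableSet_iInf]
  exact fun s hs => h s hs hA

theorem UsualConditions.measurableSet_of_ae (hU : UsualConditions 𝓕 P) {A : Set Ω}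
    (hA : ∀ᵐ ω ∂P, ω ∈ A) (t : ℝ≥0) : MeasurableSet[𝓕 t] A := by
  have h1 : MeasurableSet[𝓕 t] Aᶜ := 𝓕.mono zero_le _ (hU.complete _ hA)
  simpa using h1.compl

/-- Under the usual conditions, a non-negative martingale has a càdlàg version. -/
theorem exists_cadlag_version_martingale [IsProbabilityMeasure P] (hU : UsualConditions 𝓕 P)
    {M : ℝ≥0 → Ω → ℝ} (hM : Martingale M 𝓕 P) (hM0 : ∀ t ω, 0 ≤ M t ω) :
    ∃ X : ℝ≥0 → Ω → ℝ, StronglyAdapted 𝓕 X ∧ (∀ ω, IsCadlag fun t => X t ω) ∧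
      ∀ t, X t =ᵐ[P] M t := by
  classical
  set G : Set Ω := {ω | HasDyadicLimits fun t => M t ω}
  have hG : ∀ᵐ ω ∂P, ω ∈ G := ae_hasDyadicLimits hM hM0
  -- The right limits of `M` along dyadic times, set to zero off `G`. Completeness puts `G` into
  -- every `𝓕 t`.
  let X : ℝ≥0 → Ω → ℝ := fun t =>
    G.indicator fun ω => limUnder (𝓝[dyadics ∩ Ioi t] t) fun s => M s ω
  have hX : ∀ ω ∈ G, ∀ t, Tendsto (fun s => M s ω) (𝓝[dyadics ∩ Ioi t] t) (𝓝 (X t ω)) := by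
    intro ω hω t
    simp only [X, indicator_of_mem hω]
    exact tendsto_nhds_limUnder (hω t).1
  have hseq : ∀ t ω, Tendsto (fun n => G.indicator (M (dyadicAbove n t)) ω) atTop
      (𝓝 (X t ω)) := by
    intro t ω
    by_cases hω : ω ∈ G
    · simp only [indicator_of_mem hω]
      exact (hX ω hω t).comp (tendsto_dyadicAbove_dyadics t)
    · simp only [X, indicator_of_notMem hω]
      exact tendsto_const_nhds
  have hadapt : ∀ t, Measurable[𝓕 t] (X t) := by
    -- For each `s > t` the approximating times are eventually at most `s`; right-continuity of the
    -- filtration then gives measurability at `t` itself.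
    refine fun t => hU.measurable_of_forall_gt fun s hs => ?_
    obtain ⟨n₀, hn₀⟩ : ∃ n₀, ∀ n ≥ n₀, dyadicAbove n t ≤ s := by
      have := ((tendsto_dyadicAbove t).mono_right nhdsWithin_le_nhds).eventually_le_const hs
      exact eventually_atTop.1 this
    refine @measurable_of_tendsto_metrizable _ _ (𝓕 s) _ _ _ _
      (fun n => G.indicator (M (dyadicAbove (n + n₀) t))) _ (fun n => ?_)
      (tendsto_pi_nhds.2 fun ω => (tendsto_add_atTop_iff_nat n₀).2 (hseq t ω))
    exact ((hM.1 _).measurable.mono (𝓕.mono (hn₀ _ (Nat.le_add_left _ _))) le_rfl).indicator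
      (hU.measurableSet_of_ae hG s)
  refine ⟨X, fun t => (hadapt t).stronglyMeasurable, fun ω => ?_, fun t => ?_⟩
  · by_cases hω : ω ∈ G
    · exact isCadlag_of_tendsto_dyadics hω (hX ω hω)
    · simp only [X, indicator_of_notMem hω]
      exact isCadlag_of_continuous continuous_const
  · have hle : ∀ n, dyadicAbove n t ≤ t + 1 := fun n =>
      (dyadicAbove_le n t).trans (by gcongr; exact pow_le_one₀ zero_le (by norm_num))
    -- All approximations are conditional expectations of `M (t + 1)`, hence uniformly integrable.
    -- The almost sure convergence to `X t` thus holds in `L¹`, and integrals over sets of `𝓕 t`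
    -- pass to the limit.
    have hui : UniformIntegrable (fun n => P[M (t + 1) | 𝓕 (dyadicAbove n t)]) 1 P :=
      (hM.integrable (t + 1)).uniformIntegrable_condExp fun n => 𝓕.le _
    have hui' : UniformIntegrable (fun n => M (dyadicAbove n t)) 1 P :=
      hui.ae_eq fun n => hM.2 _ _ (hle n)
    have hlim : ∀ᵐ ω ∂P, Tendsto (fun n => M (dyadicAbove n t) ω) atTop (𝓝 (X t ω)) := by
      filter_upwards [hG] with ω hω
      exact (hX ω hω t).comp (tendsto_dyadicAbove_dyadics t)
    have hXm : AEStronglyMeasurable (X t) P :=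
      ((hadapt t).mono (𝓕.le t) le_rfl).aestronglyMeasurable
    have hXL : MemLp (X t) 1 P := hui'.memLp_of_ae_tendsto hlim
    have hL1 := tendsto_Lp_finite_of_tendsto_ae le_rfl ENNReal.one_ne_top
      (fun n => (hM.integrable _).1) hXL hui'.unifIntegrable hlim
    have hXi : Integrable (X t) P := memLp_one_iff_integrable.1 hXL
    have key : X t =ᵐ[P] P[M t | 𝓕 t] := by
      refine ae_eq_condExp_of_forall_setIntegral_eq (𝓕.le t) (hM.integrable t)
        (fun _ _ _ => hXi.integrableOn) (fun A hA _ => ?_)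
        (hadapt t).stronglyMeasurable.aestronglyMeasurable
      have h1 : Tendsto (fun n => ∫ ω in A, M (dyadicAbove n t) ω ∂P) atTop
          (𝓝 (∫ ω in A, X t ω ∂P)) :=
        tendsto_setIntegral_of_L1' _ hXi.1 (Eventually.of_forall fun n => hM.integrable _) hL1 A
      refine tendsto_nhds_unique h1 (tendsto_const_nhds.congr fun n => ?_)
      exact hM.setIntegral_eq (lt_dyadicAbove n t).le hA
    rwa [condExp_of_stronglyMeasurable (𝓕.le t) (hM.1 t) (hM.integrable t)] at key

/-! ### Conditional tail integrals of non-negative processes -/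

/-- `X` is adapted and `X t` represents `E[∫_t^∞ f⁺ ds | 𝓕_t]`, expressed by means of integrals over
the sets of `𝓕_t`. -/
def IsTail (𝓕 : Filtration ℝ≥0 m) (P : Measure Ω) (X f : ℝ≥0 → Ω → ℝ) : Prop :=
  StronglyAdapted 𝓕 X ∧ ∀ t A, MeasurableSet[𝓕 t] A →
    ∫⁻ ω in A, ENNReal.ofReal (X t ω) ∂P =
      ∫⁻ ω in A, ∫⁻ s in Ioi t, ENNReal.ofReal (f s ω) ∂leb ∂P

theorem lintegral_tail_swap [SFinite P] {f : ℝ≥0 → Ω → ℝ≥0∞} (hf : Measurable (Function.uncurry f))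
    (S : Set ℝ≥0) (A : Set Ω) :
    ∫⁻ ω in A, ∫⁻ s in S, f s ω ∂leb ∂P = ∫⁻ s in S, ∫⁻ ω in A, f s ω ∂P ∂leb :=
  lintegral_lintegral_swap (f := fun ω s => f s ω) (hf.comp measurable_swap).aemeasurable

/-- By Tonelli an almost sure comparison at each fixed time suffices: no null set common to all
times is needed. -/
theorem lintegral_tail_mono [SFinite P] {f g : ℝ≥0 → Ω → ℝ≥0∞}
    (hf : Measurable (Function.uncurry f)) (hg : Measurable (Function.uncurry g))
    (h : ∀ s, ∀ᵐ ω ∂P, f s ω ≤ g s ω) (S : Set ℝ≥0) (A : Set Ω) :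
    ∫⁻ ω in A, ∫⁻ s in S, f s ω ∂leb ∂P ≤ ∫⁻ ω in A, ∫⁻ s in S, g s ω ∂leb ∂P := by
  rw [lintegral_tail_swap hf, lintegral_tail_swap hg]
  exact lintegral_mono fun s => lintegral_mono_ae (ae_restrict_of_ae (h s))

theorem lintegral_tail_congr [SFinite P] {f g : ℝ≥0 → Ω → ℝ≥0∞}
    (hf : Measurable (Function.uncurry f)) (hg : Measurable (Function.uncurry g))
    (h : ∀ s, f s =ᵐ[P] g s) (S : Set ℝ≥0) (A : Set Ω) :
    ∫⁻ ω in A, ∫⁻ s in S, f s ω ∂leb ∂P = ∫⁻ ω in A, ∫⁻ s in S, g s ω ∂leb ∂P :=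
  le_antisymm (lintegral_tail_mono hf hg (fun s => (h s).le) S A)
    (lintegral_tail_mono hg hf (fun s => (h s).symm.le) S A)

theorem measurable_uncurry_ofReal {f : ℝ≥0 → Ω → ℝ} (hf : Measurable (Function.uncurry f)) :
    Measurable (Function.uncurry fun s ω => ENNReal.ofReal (f s ω)) :=
  ENNReal.measurable_ofReal.comp hf

/-- Both processes are adapted and their integrals over all sets of `𝓕 t` are ordered. Only `Y` has
to be non-negative, since `ENNReal.ofReal` truncates negative values. -/
theorem IsTail.le [IsFiniteMeasure P] {X Y f g : ℝ≥0 → Ω → ℝ} (hX : IsTail 𝓕 P X f)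
    (hY : IsTail 𝓕 P Y g) (hf : Measurable (Function.uncurry f))
    (hg : Measurable (Function.uncurry g)) (hY0 : ∀ t, ∀ᵐ ω ∂P, 0 ≤ Y t ω)
    (hfg : ∀ s, ∀ᵐ ω ∂P, f s ω ≤ g s ω) (t : ℝ≥0) : ∀ᵐ ω ∂P, X t ω ≤ Y t ω := by
  have hXm : Measurable[𝓕 t] fun ω => ENNReal.ofReal (X t ω) :=
    ENNReal.measurable_ofReal.comp (hX.1 t).measurable
  have hYm : Measurable[𝓕 t] fun ω => ENNReal.ofReal (Y t ω) :=
    ENNReal.measurable_ofReal.comp (hY.1 t).measurable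
  have h : (fun ω => ENNReal.ofReal (X t ω)) ≤ᵐ[P] fun ω => ENNReal.ofReal (Y t ω) := by
    refine ae_le_of_ae_le_trim (hm := 𝓕.le t) ?_
    refine ae_le_of_forall_setLIntegral_le_of_sigmaFinite hXm fun A hA _ => ?_
    rw [setLIntegral_trim (𝓕.le t) hXm hA, setLIntegral_trim (𝓕.le t) hYm hA, hX.2 t A hA,
      hY.2 t A hA]
    exact lintegral_tail_mono (measurable_uncurry_ofReal hf) (measurable_uncurry_ofReal hg)
      (fun s => (hfg s).mono fun ω h => ENNReal.ofReal_le_ofReal h) _ _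
  filter_upwards [h, hY0 t] with ω h1 h2
  exact (ENNReal.ofReal_le_ofReal_iff h2).1 h1

theorem IsTail.congr [SFinite P] {X Y f g : ℝ≥0 → Ω → ℝ} (hX : IsTail 𝓕 P X f)
    (hY : StronglyAdapted 𝓕 Y) (hf : Measurable (Function.uncurry f))
    (hg : Measurable (Function.uncurry g)) (hXY : ∀ t, X t =ᵐ[P] Y t)
    (hfg : ∀ s, f s =ᵐ[P] g s) : IsTail 𝓕 P Y g := by
  refine ⟨hY, fun t A hA => ?_⟩
  rw [← lintegral_tail_congr (measurable_uncurry_ofReal hf) (measurable_uncurry_ofReal hg)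
    (fun s => (hfg s).mono fun ω h => by simp only [h]), ← hX.2 t A hA]
  exact lintegral_congr_ae (ae_restrict_of_ae ((hXY t).mono fun ω h => by simp only [h]))

/-- The (real-valued) integral of `f⁺` over `(t, ∞)`. -/
noncomputable def tailInt (f : ℝ≥0 → Ω → ℝ) (t : ℝ≥0) (ω : Ω) : ℝ :=
  (∫⁻ s in Ioi t, ENNReal.ofReal (f s ω) ∂leb).toReal

theorem measurable_lintegral_section {f : ℝ≥0 → Ω → ℝ} (hf : Measurable (Function.uncurry f))
    (S : Set ℝ≥0) : Measurable fun ω => ∫⁻ s in S, ENNReal.ofReal (f s ω) ∂leb :=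
  Measurable.lintegral_prod_left (measurable_uncurry_ofReal hf)

theorem ae_lintegral_lt_top {f : ℝ≥0 → Ω → ℝ} (hf : Measurable (Function.uncurry f))
    (hfin : ∫⁻ ω, ∫⁻ s, ENNReal.ofReal (f s ω) ∂leb ∂P < ∞) :
    ∀ᵐ ω ∂P, ∫⁻ s, ENNReal.ofReal (f s ω) ∂leb < ∞ := by
  have := measurable_lintegral_section hf univ
  simp only [Measure.restrict_univ] at this
  exact ae_lt_top this hfin.ne

theorem integrable_lintegral_toReal {f : ℝ≥0 → Ω → ℝ} (hf : Measurable (Function.uncurry f))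
    (hfin : ∫⁻ ω, ∫⁻ s, ENNReal.ofReal (f s ω) ∂leb ∂P < ∞) (S : Set ℝ≥0) :
    Integrable (fun ω => (∫⁻ s in S, ENNReal.ofReal (f s ω) ∂leb).toReal) P :=
  integrable_toReal_of_lintegral_ne_top (measurable_lintegral_section hf S).aemeasurable
    ((lintegral_mono fun _ => setLIntegral_le_lintegral _ _).trans_lt hfin).ne

theorem setLIntegral_condExp {m₀ : MeasurableSpace Ω} [IsFiniteMeasure P] (hm : m₀ ≤ m)
    {T : Ω → ℝ} (hT : Integrable T P) (hT0 : ∀ ω, 0 ≤ T ω) {A : Set Ω} (hA : MeasurableSet[m₀] A) :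
    ∫⁻ ω in A, ENNReal.ofReal ((P[T | m₀]) ω) ∂P = ∫⁻ ω in A, ENNReal.ofReal (T ω) ∂P := by
  rw [← ofReal_integral_eq_lintegral_ofReal integrable_condExp.integrableOn
      (ae_restrict_of_ae (condExp_nonneg (Eventually.of_forall hT0))),
    ← ofReal_integral_eq_lintegral_ofReal hT.integrableOn (Eventually.of_forall hT0),
    setIntegral_condExp hm hT hA]

theorem isTail_condExp_tailInt [IsFiniteMeasure P] {f : ℝ≥0 → Ω → ℝ}
    (hf : Measurable (Function.uncurry f))
    (hfin : ∫⁻ ω, ∫⁻ s, ENNReal.ofReal (f s ω) ∂leb ∂P < ∞) :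
    IsTail 𝓕 P (fun t => P[tailInt f t | 𝓕 t]) f := by
  refine ⟨fun t => stronglyMeasurable_condExp, fun t A hA => ?_⟩
  refine (setLIntegral_condExp (𝓕.le t) (integrable_lintegral_toReal hf hfin (Ioi t))
    (fun ω => ENNReal.toReal_nonneg) hA).trans ?_
  refine lintegral_congr_ae (ae_restrict_of_ae ?_)
  filter_upwards [ae_lintegral_lt_top hf hfin] with ω hω
  exact ENNReal.ofReal_toReal ((setLIntegral_le_lintegral _ _).trans_lt hω).ne

theorem ae_integral_eq_tailInt [SFinite P] {f : ℝ≥0 → Ω → ℝ} (hf : Measurable (Function.uncurry f))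
    (hf0 : ∀ s, ∀ᵐ ω ∂P, 0 ≤ f s ω) (t : ℝ≥0) :
    (fun ω => ∫ s in Ioi t, f s ω ∂leb) =ᵐ[P] tailInt f t := by
  have h1 : ∀ᵐ ω ∂P, ∀ᵐ s ∂leb, 0 ≤ f s ω :=
    (Measure.ae_ae_comm (p := fun ω s => 0 ≤ f s ω) (measurableSet_le measurable_const (hf.comp measurable_swap))).2
      (Eventually.of_forall hf0)
  filter_upwards [h1] with ω hω
  exact integral_eq_lintegral_of_nonneg_ae (ae_restrict_of_ae hω)
    (hf.comp (measurable_id.prodMk measurable_const)).aestronglyMeasurable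

theorem condTail_ae_eq [IsFiniteMeasure P] {f : ℝ≥0 → Ω → ℝ} (hf : Measurable (Function.uncurry f))
    (hf0 : ∀ s, ∀ᵐ ω ∂P, 0 ≤ f s ω) (t : ℝ≥0) :
    condTail 𝓕 P f t =ᵐ[P] P[tailInt f t | 𝓕 t] :=
  condExp_congr_ae (ae_integral_eq_tailInt hf hf0 t)

theorem isTail_condTail [IsFiniteMeasure P] {f : ℝ≥0 → Ω → ℝ} (hf : Measurable (Function.uncurry f))
    (hf0 : ∀ s, ∀ᵐ ω ∂P, 0 ≤ f s ω)
    (hfin : ∫⁻ ω, ∫⁻ s, ENNReal.ofReal (f s ω) ∂leb ∂P < ∞) :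
    IsTail 𝓕 P (condTail 𝓕 P f) f :=
  (isTail_condExp_tailInt hf hfin).congr (fun _ => stronglyMeasurable_condExp) hf hf
    (fun t => (condTail_ae_eq hf hf0 t).symm) fun _ => EventuallyEq.rfl

theorem condTail_nonneg [IsFiniteMeasure P] {f : ℝ≥0 → Ω → ℝ} (hf : Measurable (Function.uncurry f))
    (hf0 : ∀ s, ∀ᵐ ω ∂P, 0 ≤ f s ω) (t : ℝ≥0) : ∀ᵐ ω ∂P, 0 ≤ condTail 𝓕 P f t ω := by
  filter_upwards [condTail_ae_eq (𝓕 := 𝓕) hf hf0 t, condExp_nonneg (m := 𝓕 t) (μ := P)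
    (f := tailInt f t) (Eventually.of_forall fun ω => ENNReal.toReal_nonneg)] with ω h1 h2
  rw [h1]
  exact h2

theorem IsTail.ae_eq [IsFiniteMeasure P] {X Y f : ℝ≥0 → Ω → ℝ} (hX : IsTail 𝓕 P X f)
    (hY : IsTail 𝓕 P Y f) (hf : Measurable (Function.uncurry f)) (hX0 : ∀ t, ∀ᵐ ω ∂P, 0 ≤ X t ω)
    (hY0 : ∀ t, ∀ᵐ ω ∂P, 0 ≤ Y t ω) (t : ℝ≥0) : X t =ᵐ[P] Y t := by
  filter_upwards [hX.le hY hf hf hY0 (fun _ => Eventually.of_forall fun _ => le_rfl) t,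
    hY.le hX hf hf hX0 (fun _ => Eventually.of_forall fun _ => le_rfl) t] with ω h1 h2
  exact le_antisymm h1 h2

/-- The bridge between integrals over sets and `condExp`. Finiteness matters because `condExp` of a
non-integrable function is zero by convention. -/
theorem isTail_iff_condTail [IsFiniteMeasure P] {X f : ℝ≥0 → Ω → ℝ} (hX : StronglyAdapted 𝓕 X)
    (hX0 : ∀ t, ∀ᵐ ω ∂P, 0 ≤ X t ω) (hf : Measurable (Function.uncurry f))
    (hf0 : ∀ s, ∀ᵐ ω ∂P, 0 ≤ f s ω)
    (hfin : ∫⁻ ω, ∫⁻ s, ENNReal.ofReal (f s ω) ∂leb ∂P < ∞) :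
    IsTail 𝓕 P X f ↔ ∀ t, X t =ᵐ[P] condTail 𝓕 P f t :=
  ⟨fun h => h.ae_eq (isTail_condTail hf hf0 hfin) hf hX0 (condTail_nonneg hf hf0),
    fun h => (isTail_condTail hf hf0 hfin).congr hX hf hf (fun t => (h t).symm)
      fun _ => EventuallyEq.rfl⟩

theorem isCadlag_lintegral_Iic {f : ℝ≥0 → ℝ≥0∞} (hf : Measurable f) (hfin : ∫⁻ s, f s ∂leb < ∞) :
    IsCadlag fun t => (∫⁻ s in Iic t, f s ∂leb).toReal := by
  have key : ∀ (t : ℝ≥0) (l : Filter ℝ≥0) [l.IsCountablyGenerated] (S : Set ℝ≥0), MeasurableSet S →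
      (∀ s, ∀ᶠ u in l, (s ∈ Iic u ↔ s ∈ S)) →
      Tendsto (fun u => (∫⁻ s in Iic u, f s ∂leb).toReal) l (𝓝 (∫⁻ s in S, f s ∂leb).toReal) := by
    intro t l _ S hS h
    refine (ENNReal.tendsto_toReal ((setLIntegral_le_lintegral _ _).trans_lt hfin).ne).comp ?_
    simp_rw [← lintegral_indicator measurableSet_Iic, ← lintegral_indicator hS]
    refine tendsto_lintegral_filter_of_dominated_convergence f
      (Eventually.of_forall fun u => hf.indicator measurableSet_Iic)
      (Eventually.of_forall fun u => Eventually.of_forall fun s => indicator_le_self _ _ _)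
      hfin.ne (Eventually.of_forall fun s => ?_)
    refine tendsto_const_nhds.congr' ((h s).mono fun u hu => ?_)
    change _ = (Iic u).indicator f s
    by_cases hs : s ∈ S
    · rw [indicator_of_mem hs, indicator_of_mem (hu.2 hs)]
    · rw [indicator_of_notMem hs, indicator_of_notMem (mt hu.1 hs)]
  intro t
  refine ⟨key t _ _ measurableSet_Iic fun s => ?_, _, key t _ (Iio t) measurableSet_Iio fun s => ?_⟩
  · rcases le_or_gt s t with h | h
    · filter_upwards [self_mem_nhdsWithin] with u hu
      exact iff_of_true (h.trans hu) h
    · filter_upwards [eventually_nhdsWithin_of_eventually_nhds (eventually_lt_nhds h)] with u hu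
      exact iff_of_false (not_le.2 hu) (not_le.2 h)
  · rcases lt_or_ge s t with h | h
    · filter_upwards [eventually_nhdsWithin_of_eventually_nhds (eventually_gt_nhds h)] with u hu
      exact iff_of_true hu.le h
    · filter_upwards [self_mem_nhdsWithin] with u hu
      exact iff_of_false (not_le.2 (lt_of_lt_of_le hu h)) (not_lt.2 h)

theorem measurable_lintegral_subtype {m₀ : MeasurableSpace Ω} {t : ℝ≥0} {f : ℝ≥0 → Ω → ℝ}
    (hf : Measurable fun p : Iic t × Ω => f p.1 p.2) :
    Measurable fun ω => ∫⁻ s in Iic t, ENNReal.ofReal (f s ω) ∂leb := by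
  have h1 : ∀ ω, ∫⁻ s in Iic t, ENNReal.ofReal (f s ω) ∂leb =
      ∫⁻ s in Iic t, ENNReal.ofReal (f (min s t) ω) ∂leb := fun ω =>
    setLIntegral_congr_fun measurableSet_Iic fun s hs => by
      simp only [min_eq_left (show s ≤ t from hs)]
  simp_rw [h1]
  have h2 : Measurable fun p : ℝ≥0 × Ω =>
      ((⟨min p.1 t, mem_Iic.2 (min_le_right _ _)⟩ : Iic t), p.2) :=
    ((measurable_fst.min measurable_const).subtype_mk).prodMk measurable_snd
  exact Measurable.lintegral_prod_left (f := fun s ω => ENNReal.ofReal (f (min s t) ω))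
    (ENNReal.measurable_ofReal.comp (hf.comp h2))

theorem stronglyMeasurable_max_zero {m₀ : MeasurableSpace Ω} {X : Ω → ℝ}
    (hX : StronglyMeasurable X) : StronglyMeasurable fun ω => max (X ω) 0 :=
  hX.sup stronglyMeasurable_const

/-- Under the usual conditions, the conditional tail integral of a progressively measurable process
has a non-negative càdlàg version. -/
theorem exists_cadlag_isTail [IsProbabilityMeasure P] (hU : UsualConditions 𝓕 P)
    {f : ℝ≥0 → Ω → ℝ} (hf : IsStronglyProgressive 𝓕 f)
    (hfin : ∫⁻ ω, ∫⁻ s, ENNReal.ofReal (f s ω) ∂leb ∂P < ∞) :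
    ∃ X : ℝ≥0 → Ω → ℝ, IsTail 𝓕 P X f ∧ (∀ ω, IsCadlag fun t => X t ω) ∧ ∀ t ω, 0 ≤ X t ω := by
  have hfm := measurable_uncurry_of_progressive hf
  set ξ : Ω → ℝ := fun ω => (∫⁻ s, ENNReal.ofReal (f s ω) ∂leb).toReal with hξ
  have hξi : Integrable ξ P := by
    simpa only [Measure.restrict_univ] using integrable_lintegral_toReal hfm hfin univ
  set B : ℝ≥0 → Ω → ℝ := fun t ω => (∫⁻ s in Iic t, ENNReal.ofReal (f s ω) ∂leb).toReal with hB
  have hBi : ∀ t, Integrable (B t) P := fun t => integrable_lintegral_toReal hfm hfin _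
  have hBm : ∀ t, Measurable[𝓕 t] (B t) := fun t =>
    ENNReal.measurable_toReal.comp (@measurable_lintegral_subtype _ (𝓕 t) t f (hf t).measurable)
  set G : Set Ω := {ω | ∫⁻ s, ENNReal.ofReal (f s ω) ∂leb < ∞}
  have hG : ∀ᵐ ω ∂P, ω ∈ G := ae_lintegral_lt_top hfm hfin
  -- The maximum with zero makes the martingale non-negative at every `ω`, as the construction of
  -- the càdlàg version demands, and changes it only on null sets.
  have hM : Martingale (fun t ω => max ((P[ξ | 𝓕 t]) ω) 0) 𝓕 P := by
    have h1 : ∀ t, (fun ω => max ((P[ξ | 𝓕 t]) ω) 0) =ᵐ[P] P[ξ | 𝓕 t] := fun t => by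
      filter_upwards [condExp_nonneg (m := 𝓕 t) (μ := P) (f := ξ)
        (Eventually.of_forall fun ω => ENNReal.toReal_nonneg)] with ω h
      exact max_eq_left h
    exact ⟨fun t => stronglyMeasurable_max_zero stronglyMeasurable_condExp, fun s t hst =>
      (condExp_congr_ae (h1 t)).trans ((condExp_condExp_of_le (𝓕.mono hst) (𝓕.le t)).trans
        (h1 s).symm)⟩
  obtain ⟨Y, hYa, hYc, hY⟩ := exists_cadlag_version_martingale hU hM fun t ω => le_max_right _ _
  -- The tail after `t` is the total integral minus the part `B t` up to `t`, which is `𝓕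
  -- t`-measurable.
  have hXa : StronglyAdapted 𝓕 fun t ω => max (G.indicator (fun ω => Y t ω - B t ω) ω) 0 :=
    fun t => stronglyMeasurable_max_zero (((hYa t).measurable.sub (hBm t)).indicator
      (hU.measurableSet_of_ae hG t)).stronglyMeasurable
  refine ⟨fun t ω => max (G.indicator (fun ω => Y t ω - B t ω) ω) 0, ?_, fun ω => ?_,
    fun t ω => le_max_right _ _⟩
  · refine (isTail_condExp_tailInt hfm hfin).congr hXa hfm hfm (fun t => ?_)
      fun _ => EventuallyEq.rfl
    have h1 : tailInt f t =ᵐ[P] ξ - B t := by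
      filter_upwards [hG] with ω hω
      have h2 : ∫⁻ s, ENNReal.ofReal (f s ω) ∂leb = ∫⁻ s in Iic t, ENNReal.ofReal (f s ω) ∂leb +
          ∫⁻ s in Ioi t, ENNReal.ofReal (f s ω) ∂leb := by
        rw [← lintegral_add_compl _ (measurableSet_Iic (a := t)), compl_Iic]
      simp only [Pi.sub_apply, hξ, hB, tailInt]
      rw [h2, ENNReal.toReal_add ((setLIntegral_le_lintegral _ _).trans_lt hω).ne
        ((setLIntegral_le_lintegral _ _).trans_lt hω).ne]
      ring
    have h3 : P[tailInt f t | 𝓕 t] =ᵐ[P] P[ξ | 𝓕 t] - B t := by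
      refine (condExp_congr_ae h1).trans ((condExp_sub hξi (hBi t) _).trans ?_)
      rw [condExp_of_stronglyMeasurable (𝓕.le t) (hBm t).stronglyMeasurable (hBi t)]
    filter_upwards [hG, h3, hY t, condExp_nonneg (m := 𝓕 t) (μ := P) (f := tailInt f t)
      (Eventually.of_forall fun ω => ENNReal.toReal_nonneg), condExp_nonneg (m := 𝓕 t) (μ := P)
      (f := ξ) (Eventually.of_forall fun ω => ENNReal.toReal_nonneg)] with ω h4 h5 h6 h7 h8
    have h8' : 0 ≤ (P[ξ | 𝓕 t]) ω := h8
    have h7' : 0 ≤ (P[tailInt f t | 𝓕 t]) ω := h7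
    rw [indicator_of_mem h4, h6, max_eq_left h8', h5, max_eq_left]
    · rfl
    · rw [h5] at h7'
      exact h7'
  · by_cases hω : ω ∈ G
    · simp only [indicator_of_mem hω]
      exact (hYc ω).comp_continuous₂ (isCadlag_lintegral_Iic
        (ENNReal.measurable_ofReal.comp (hfm.comp (measurable_id.prodMk measurable_const))) hω)
        (φ := fun x y => max (x - y) 0) (by fun_prop)
    · simp only [indicator_of_notMem hω]
      exact isCadlag_of_continuous continuous_const

/-! ### Discounting -/

theorem measurable_section {β : Type*} [MeasurableSpace β] {F : ℝ≥0 → Ω → β}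
    (h : Measurable (Function.uncurry F)) (ω : Ω) : Measurable fun s => F s ω :=
  h.comp (measurable_id.prodMk measurable_const)

theorem measurable_at_time {β : Type*} [MeasurableSpace β] {F : ℝ≥0 → Ω → β}
    (h : Measurable (Function.uncurry F)) (s : ℝ≥0) : Measurable fun ω => F s ω :=
  h.comp (measurable_const.prodMk measurable_id)

theorem setLIntegral_leb_Ioo (φ : ℝ → ℝ≥0∞) (t r : ℝ≥0) :
    ∫⁻ s in Ioo t r, φ s ∂leb = ∫⁻ x in Ioo (t : ℝ) r, φ x := by
  have h := setLIntegral_subtype (μ := (volume : Measure ℝ)) (s := {x : ℝ | 0 ≤ x})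
    measurableSet_Ici (Ioo (t : ℝ≥0) r : Set ℝ≥0) φ
  have h2 : (Subtype.val '' (Ioo t r : Set ℝ≥0) : Set ℝ) = Ioo (t : ℝ) r := by
    ext x
    constructor
    · rintro ⟨y, hy, rfl⟩
      exact ⟨by exact_mod_cast hy.1, by exact_mod_cast hy.2⟩
    · intro hx
      exact ⟨⟨x, t.2.trans hx.1.le⟩, ⟨hx.1, hx.2⟩, rfl⟩
  exact h.trans (congrArg (fun S : Set ℝ => ∫⁻ x in S, φ x) h2)

theorem setLIntegral_leb_Ioo_deriv {F F' : ℝ → ℝ} (hF : ∀ x, HasDerivAt F (F' x) x)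
    (hc : Continuous F') (h0 : ∀ x, 0 ≤ F' x) {t r : ℝ≥0} (htr : t ≤ r) :
    ∫⁻ s in Ioo t r, ENNReal.ofReal (F' s) ∂leb = ENNReal.ofReal (F r - F t) := by
  rw [setLIntegral_leb_Ioo fun x => ENNReal.ofReal (F' x)]
  have h1 : IntervalIntegrable F' volume t r := hc.intervalIntegrable _ _
  rw [← intervalIntegral.integral_eq_sub_of_hasDerivAt (fun x _ => hF x) h1,
    intervalIntegral.integral_of_le (by exact_mod_cast htr), integral_Ioc_eq_integral_Ioo,
    ofReal_integral_eq_lintegral_ofReal _ (Eventually.of_forall h0)]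
  exact ((intervalIntegrable_iff_integrableOn_Ioo_of_le (by exact_mod_cast htr)).1 h1)

/-- A set of `𝓕 t` lies in `𝓕 s` for `s > t`, so under the integral `Y s` may be replaced by the
integral of `g` over `(s, ∞)`. Tonelli on `t < s < r` then moves the weight `φ` onto `g`. -/
theorem IsTail.lintegral_mul [SFinite P] {Y g : ℝ≥0 → Ω → ℝ} (hY : IsTail 𝓕 P Y g)
    (hYm : Measurable (Function.uncurry Y)) (hg : Measurable (Function.uncurry g))
    {φ : ℝ≥0 → ℝ≥0∞} (hφ : Measurable φ) (t : ℝ≥0) {A : Set Ω} (hA : MeasurableSet[𝓕 t] A) :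
    ∫⁻ ω in A, ∫⁻ s in Ioi t, φ s * ENNReal.ofReal (Y s ω) ∂leb ∂P =
      ∫⁻ ω in A, ∫⁻ r in Ioi t, (∫⁻ s in Ioo t r, φ s ∂leb) * ENNReal.ofReal (g r ω) ∂leb ∂P := by
  have hgm := measurable_uncurry_ofReal hg
  have hlt : MeasurableSet {q : ℝ≥0 × ℝ≥0 | q.1 < q.2} :=
    measurableSet_lt measurable_fst measurable_snd
  have hind : ∀ s ω, ∫⁻ r in Ioi s, ENNReal.ofReal (g r ω) ∂leb =
      ∫⁻ r, {q : ℝ≥0 × ℝ≥0 | q.1 < q.2}.indicator (fun q => ENNReal.ofReal (g q.2 ω)) (s, r)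
        ∂leb := by
    intro s ω
    rw [← lintegral_indicator measurableSet_Ioi]
    rfl
  have hjoint : Measurable (Function.uncurry fun (s : ℝ≥0) ω =>
      ∫⁻ r in Ioi s, ENNReal.ofReal (g r ω) ∂leb) := by
    have h1 : Measurable fun x : (ℝ≥0 × Ω) × ℝ≥0 =>
        {y : (ℝ≥0 × Ω) × ℝ≥0 | y.1.1 < y.2}.indicator (fun y => ENNReal.ofReal (g y.2 y.1.2)) x :=
      Measurable.indicator (hgm.comp (measurable_snd.prodMk (measurable_snd.comp measurable_fst)))
        (measurableSet_lt (measurable_fst.comp measurable_fst) measurable_snd)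
    have h2 := h1.lintegral_prod_right' (ν := leb)
    convert h2 using 1
    ext ⟨s, ω⟩
    exact hind s ω
  have hφY : Measurable (Function.uncurry fun s ω => φ s * ENNReal.ofReal (Y s ω)) :=
    (hφ.comp measurable_fst).mul (measurable_uncurry_ofReal hYm)
  have hφg : Measurable (Function.uncurry fun s ω =>
      φ s * ∫⁻ r in Ioi s, ENNReal.ofReal (g r ω) ∂leb) :=
    (hφ.comp measurable_fst).mul hjoint
  calc ∫⁻ ω in A, ∫⁻ s in Ioi t, φ s * ENNReal.ofReal (Y s ω) ∂leb ∂P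
      = ∫⁻ s in Ioi t, ∫⁻ ω in A, φ s * ENNReal.ofReal (Y s ω) ∂P ∂leb :=
        lintegral_tail_swap hφY _ _
    _ = ∫⁻ s in Ioi t, ∫⁻ ω in A, φ s * ∫⁻ r in Ioi s, ENNReal.ofReal (g r ω) ∂leb ∂P ∂leb := by
        refine setLIntegral_congr_fun measurableSet_Ioi fun s hs => ?_
        rw [lintegral_const_mul _ (measurable_at_time (measurable_uncurry_ofReal hYm) s),
          lintegral_const_mul _ (measurable_at_time hjoint s),
          hY.2 s A (𝓕.mono (le_of_lt hs) _ hA)]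
    _ = ∫⁻ ω in A, ∫⁻ s in Ioi t, φ s * ∫⁻ r in Ioi s, ENNReal.ofReal (g r ω) ∂leb ∂leb ∂P :=
        (lintegral_tail_swap hφg _ _).symm
    _ = _ := by
        refine lintegral_congr fun ω => ?_
        have hgω : Measurable fun r => ENNReal.ofReal (g r ω) :=
          measurable_section hgm ω
        have h3 : ∀ s, φ s * ∫⁻ r in Ioi s, ENNReal.ofReal (g r ω) ∂leb =
            ∫⁻ r, {q : ℝ≥0 × ℝ≥0 | q.1 < q.2}.indicator
              (fun q => φ q.1 * ENNReal.ofReal (g q.2 ω)) (s, r) ∂leb := by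
          intro s
          rw [← lintegral_const_mul _ hgω, ← lintegral_indicator measurableSet_Ioi]
          rfl
        have h4 : Measurable fun q : ℝ≥0 × ℝ≥0 => {q : ℝ≥0 × ℝ≥0 | q.1 < q.2}.indicator
              (fun q => φ q.1 * ENNReal.ofReal (g q.2 ω)) q :=
          ((hφ.comp measurable_fst).mul (hgω.comp measurable_snd)).indicator hlt
        simp_rw [h3]
        rw [lintegral_lintegral_swap h4.aemeasurable, ← lintegral_indicator measurableSet_Ioi]
        refine lintegral_congr fun r => ?_
        have h5 : ∀ s, {q : ℝ≥0 × ℝ≥0 | q.1 < q.2}.indicator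
              (fun q => φ q.1 * ENNReal.ofReal (g q.2 ω)) (s, r) =
            (Iio r).indicator (fun s => φ s * ENNReal.ofReal (g r ω)) s := fun s => rfl
        simp_rw [h5]
        rw [lintegral_indicator measurableSet_Iio, Measure.restrict_restrict measurableSet_Iio,
          Iio_inter_Ioi, lintegral_mul_const _ hφ]
        by_cases hr : r ∈ Ioi t
        · rw [indicator_of_mem hr]
        · rw [indicator_of_notMem hr, Ioo_eq_empty hr]
          simp

theorem hasDerivAt_exp_mul (c x : ℝ) :
    HasDerivAt (fun x => Real.exp (c * x)) (c * Real.exp (c * x)) x := by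
  have h : HasDerivAt (fun x => c * x) c x := by simpa using (hasDerivAt_id' x).const_mul c
  simpa [mul_comm] using h.exp

theorem measurable_exp_mul (c : ℝ) : Measurable fun s : ℝ≥0 => Real.exp (c * s) := by fun_prop

theorem measurable_uncurry_exp_mul {f : ℝ≥0 → Ω → ℝ} (hf : Measurable (Function.uncurry f))
    (c : ℝ) : Measurable (Function.uncurry fun (s : ℝ≥0) ω => Real.exp (c * s) * f s ω) :=
  ((measurable_exp_mul c).comp measurable_fst).mul hf

/-- Integration by parts: the term `c exp (-c s) X s` contributes `(exp (-c t) - exp (-c r)) f r`,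
and adding `exp (-c r) f r` leaves `exp (-c t) f r`. All terms are non-negative, so no integrability
is needed. -/
theorem IsTail.discount [SFinite P] {X f : ℝ≥0 → Ω → ℝ} {c : ℝ} (hc : 0 ≤ c)
    (hX : IsTail 𝓕 P X f) (hXm : Measurable (Function.uncurry X))
    (hf : Measurable (Function.uncurry f)) (hX0 : ∀ t, ∀ᵐ ω ∂P, 0 ≤ X t ω)
    (hf0 : ∀ t, ∀ᵐ ω ∂P, 0 ≤ f t ω) :
    IsTail 𝓕 P (fun t ω => Real.exp (-c * t) * X t ω)
      (fun t ω => Real.exp (-c * t) * (f t ω + c * X t ω)) := by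
  refine ⟨fun t => (hX.1 t).const_mul _, fun t A hA => ?_⟩
  set φ : ℝ≥0 → ℝ≥0∞ := fun s => ENNReal.ofReal (c * Real.exp (-c * s))
  have hφ : Measurable φ := ENNReal.measurable_ofReal.comp ((measurable_exp_mul _).const_mul c)
  have he : Measurable fun s : ℝ≥0 => ENNReal.ofReal (Real.exp (-c * s)) :=
    ENNReal.measurable_ofReal.comp (measurable_exp_mul _)
  have hfm := measurable_uncurry_ofReal hf
  have hXm' := measurable_uncurry_ofReal hXm
  have h1 : ∫⁻ ω in A, ∫⁻ s in Ioi t,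
        ENNReal.ofReal (Real.exp (-c * s) * (f s ω + c * X s ω)) ∂leb ∂P =
      ∫⁻ ω in A, ∫⁻ s in Ioi t, (ENNReal.ofReal (Real.exp (-c * s)) * ENNReal.ofReal (f s ω) +
        φ s * ENNReal.ofReal (X s ω)) ∂leb ∂P := by
    refine lintegral_tail_congr (g := fun (s : ℝ≥0) ω => ENNReal.ofReal (Real.exp (-c * s)) *
        ENNReal.ofReal (f s ω) + φ s * ENNReal.ofReal (X s ω))
      (measurable_uncurry_ofReal (measurable_uncurry_exp_mul (f := fun s ω => f s ω + c * X s ω)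
      (hf.add (hXm.const_mul c)) _))
      (((he.comp measurable_fst).mul hfm).add ((hφ.comp measurable_fst).mul hXm'))
      (fun s => ?_) _ _
    filter_upwards [hX0 s, hf0 s] with ω h2 h3
    have h4 := Real.exp_pos (-c * s)
    rw [← ENNReal.ofReal_mul h4.le, ← ENNReal.ofReal_mul (by positivity),
      ← ENNReal.ofReal_add (by positivity) (by positivity)]
    ring_nf
  have h2 : ∀ r ∈ Ioi t, ∫⁻ s in Ioo t r, φ s ∂leb =
      ENNReal.ofReal (Real.exp (-c * t) - Real.exp (-c * r)) := by
    intro r hr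
    have := setLIntegral_leb_Ioo_deriv (F := fun x => -Real.exp (-c * x))
      (F' := fun x => c * Real.exp (-c * x)) (fun x => ?_) (by fun_prop)
      (fun x => by positivity) (le_of_lt hr)
    · rw [this]
      ring_nf
    · exact (hasDerivAt_exp_mul (-c) x).fun_neg.congr_deriv (by ring)
  rw [h1]
  have h3 : ∀ ω, ∫⁻ s in Ioi t, (ENNReal.ofReal (Real.exp (-c * s)) * ENNReal.ofReal (f s ω) +
        φ s * ENNReal.ofReal (X s ω)) ∂leb =
      ∫⁻ s in Ioi t, ENNReal.ofReal (Real.exp (-c * s)) * ENNReal.ofReal (f s ω) ∂leb +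
        ∫⁻ s in Ioi t, φ s * ENNReal.ofReal (X s ω) ∂leb := fun ω =>
    lintegral_add_left (he.mul (measurable_section hfm ω)) _
  simp_rw [h3]
  have h4 : Measurable fun ω =>
      ∫⁻ s in Ioi t, ENNReal.ofReal (Real.exp (-c * s)) * ENNReal.ofReal (f s ω) ∂leb :=
    Measurable.lintegral_prod_left ((he.comp measurable_fst).mul hfm)
  rw [lintegral_add_left h4, hX.lintegral_mul hXm hf hφ t hA, ← lintegral_add_left h4]
  have h5 : ∀ ω, ∫⁻ s in Ioi t, ENNReal.ofReal (Real.exp (-c * s)) * ENNReal.ofReal (f s ω) ∂leb +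
      ∫⁻ r in Ioi t, (∫⁻ s in Ioo t r, φ s ∂leb) * ENNReal.ofReal (f r ω) ∂leb =
      ENNReal.ofReal (Real.exp (-c * t)) * ∫⁻ s in Ioi t, ENNReal.ofReal (f s ω) ∂leb := by
    intro ω
    have hfω : Measurable fun s => ENNReal.ofReal (f s ω) :=
      measurable_section hfm ω
    rw [← lintegral_add_left (f := fun s : ℝ≥0 => ENNReal.ofReal (Real.exp (-c * s)) *
      ENNReal.ofReal (f s ω)) (he.mul hfω), ← lintegral_const_mul _ hfω]
    refine setLIntegral_congr_fun measurableSet_Ioi fun s hs => ?_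
    rw [h2 s hs, ← add_mul, ← ENNReal.ofReal_add (Real.exp_pos _).le]
    · ring_nf
    · rw [sub_nonneg, Real.exp_le_exp]
      have : (t : ℝ) ≤ s := by exact_mod_cast le_of_lt hs
      nlinarith
  simp_rw [h5]
  rw [lintegral_const_mul _ (measurable_lintegral_section hf _), ← hX.2 t A hA,
    ← lintegral_const_mul _ (measurable_at_time hXm' t)]
  simp_rw [ENNReal.ofReal_mul (Real.exp_pos _).le]

/-- With `g` the discounted integrand, the tail of `c X` contributes `(exp (c r) - exp (c t)) g r`
and `X t` contributes `exp (c t) g r`; their sum is the tail of `c X + f`. -/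
theorem IsTail.of_discount [SFinite P] {X f : ℝ≥0 → Ω → ℝ} {c : ℝ} (hc : 0 ≤ c)
    (hX : IsTail 𝓕 P (fun t ω => Real.exp (-c * t) * X t ω)
      (fun t ω => Real.exp (-c * t) * (f t ω + c * X t ω)))
    (hXm : Measurable (Function.uncurry X))
    (hf : Measurable (Function.uncurry f)) (hX0 : ∀ t, ∀ᵐ ω ∂P, 0 ≤ X t ω)
    (hf0 : ∀ t, ∀ᵐ ω ∂P, 0 ≤ f t ω) (hfin : ∫⁻ ω, ∫⁻ s, ENNReal.ofReal (X s ω) ∂leb ∂P < ∞) :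
    IsTail 𝓕 P X f := by
  have hcancel : ∀ t : ℝ≥0, Real.exp (c * t) * Real.exp (-c * t) = 1 := fun t => by
    rw [← Real.exp_add]
    simp
  refine ⟨fun t => ?_, fun t A hA => ?_⟩
  · have h := (hX.1 t).const_mul (Real.exp (c * t))
    convert h using 2 with ω
    rw [← mul_assoc, hcancel, one_mul]
  set Y : ℝ≥0 → Ω → ℝ := fun t ω => Real.exp (-c * t) * X t ω with hYdef
  set g : ℝ≥0 → Ω → ℝ := fun t ω => Real.exp (-c * t) * (f t ω + c * X t ω) with hgdef
  have hYm : Measurable (Function.uncurry Y) := measurable_uncurry_exp_mul hXm _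
  have hg : Measurable (Function.uncurry g) :=
    measurable_uncurry_exp_mul (f := fun s ω => f s ω + c * X s ω)
      (hf.add (hXm.const_mul c)) _
  set φ : ℝ≥0 → ℝ≥0∞ := fun s => ENNReal.ofReal (c * Real.exp (c * s))
  have hφ : Measurable φ := ENNReal.measurable_ofReal.comp ((measurable_exp_mul _).const_mul c)
  have hgm := measurable_uncurry_ofReal hg
  have hcX : Measurable (Function.uncurry fun s ω => ENNReal.ofReal (c * X s ω)) :=
    measurable_uncurry_ofReal (hXm.const_mul c)
  have h1 : ∀ ω, ∫⁻ s in Ioi t, ENNReal.ofReal (c * X s ω) ∂leb =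
      ∫⁻ s in Ioi t, φ s * ENNReal.ofReal (Y s ω) ∂leb := by
    intro ω
    refine lintegral_congr fun s => ?_
    rw [← ENNReal.ofReal_mul (by positivity)]
    congr 1
    linear_combination (-(c * X s ω)) * hcancel s
  have h2 : ∀ r ∈ Ioi t, ∫⁻ s in Ioo t r, φ s ∂leb =
      ENNReal.ofReal (Real.exp (c * r) - Real.exp (c * t)) := by
    intro r hr
    refine setLIntegral_leb_Ioo_deriv (F := fun x => Real.exp (c * x))
      (F' := fun x => c * Real.exp (c * x)) (fun x => ?_) (by fun_prop)
      (fun x => by positivity) (le_of_lt hr)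
    exact hasDerivAt_exp_mul c x
  have h3 : ∫⁻ ω in A, ENNReal.ofReal (X t ω) ∂P =
      ∫⁻ ω in A, ∫⁻ r in Ioi t, ENNReal.ofReal (Real.exp (c * t)) * ENNReal.ofReal (g r ω)
        ∂leb ∂P := by
    have h4 : ∀ ω, ENNReal.ofReal (X t ω) =
        ENNReal.ofReal (Real.exp (c * t)) * ENNReal.ofReal (Y t ω) := by
      intro ω
      rw [← ENNReal.ofReal_mul (Real.exp_pos _).le]
      congr 1
      linear_combination (-(X t ω)) * hcancel t
    simp_rw [h4]
    rw [lintegral_const_mul _ (measurable_at_time (measurable_uncurry_ofReal hYm) t), hX.2 t A hA,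
      ← lintegral_const_mul _ (measurable_lintegral_section hg _)]
    refine lintegral_congr fun ω => ?_
    rw [← lintegral_const_mul _ (measurable_section hgm ω)]
  have h5 : ∫⁻ ω in A, ∫⁻ s in Ioi t, ENNReal.ofReal (c * X s ω) ∂leb ∂P +
        ∫⁻ ω in A, ENNReal.ofReal (X t ω) ∂P =
      ∫⁻ ω in A, ∫⁻ s in Ioi t, ENNReal.ofReal (c * X s ω) ∂leb ∂P +
        ∫⁻ ω in A, ∫⁻ s in Ioi t, ENNReal.ofReal (f s ω) ∂leb ∂P := by
    have h6 : ∫⁻ ω in A, ∫⁻ s in Ioi t, ENNReal.ofReal (c * X s ω) ∂leb ∂P =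
        ∫⁻ ω in A, ∫⁻ r in Ioi t, ENNReal.ofReal (Real.exp (c * r) - Real.exp (c * t)) *
          ENNReal.ofReal (g r ω) ∂leb ∂P := by
      simp_rw [h1]
      rw [hX.lintegral_mul hYm hg hφ t hA]
      refine lintegral_congr fun ω => setLIntegral_congr_fun measurableSet_Ioi fun r hr => ?_
      rw [h2 r hr]
    have hm1 : Measurable (Function.uncurry fun (r : ℝ≥0) ω =>
        ENNReal.ofReal (Real.exp (c * r) - Real.exp (c * t)) * ENNReal.ofReal (g r ω)) :=
      (ENNReal.measurable_ofReal.comp (((measurable_exp_mul c).sub_const _).comp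
        measurable_fst)).mul hgm
    have h7 : ∫⁻ ω in A, ∫⁻ s in Ioi t, ENNReal.ofReal (c * X s ω) ∂leb ∂P +
        ∫⁻ ω in A, ENNReal.ofReal (X t ω) ∂P =
        ∫⁻ ω in A, ∫⁻ r in Ioi t, ENNReal.ofReal (c * X r ω + f r ω) ∂leb ∂P := by
      rw [h6, h3, ← lintegral_add_left (Measurable.lintegral_prod_left hm1)]
      refine lintegral_congr fun ω => ?_
      rw [← lintegral_add_left (measurable_section hm1 ω)]
      refine setLIntegral_congr_fun measurableSet_Ioi fun r hr => ?_
      rw [← add_mul, ← ENNReal.ofReal_add, ← ENNReal.ofReal_mul]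
      · congr 1
        linear_combination (f r ω + c * X r ω) * hcancel r
      · rw [sub_add_cancel]
        positivity
      · rw [sub_nonneg, Real.exp_le_exp]
        have : (t : ℝ) ≤ r := by exact_mod_cast le_of_lt hr
        nlinarith
      · positivity
    rw [h7, ← lintegral_add_left (Measurable.lintegral_prod_left hcX)]
    have h8 : ∀ ω, ∫⁻ s in Ioi t, ENNReal.ofReal (c * X s ω) ∂leb +
        ∫⁻ s in Ioi t, ENNReal.ofReal (f s ω) ∂leb =
        ∫⁻ s in Ioi t, (ENNReal.ofReal (c * X s ω) + ENNReal.ofReal (f s ω)) ∂leb := fun ω =>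
      (lintegral_add_left (measurable_section hcX ω) _).symm
    simp_rw [h8]
    refine lintegral_tail_congr
      (g := fun s ω => ENNReal.ofReal (c * X s ω) + ENNReal.ofReal (f s ω))
      (measurable_uncurry_ofReal (f := fun s ω => c * X s ω + f s ω)
      ((hXm.const_mul c).add hf))
      (hcX.add (measurable_uncurry_ofReal hf)) (fun s => ?_) _ _
    filter_upwards [hX0 s, hf0 s] with ω h9 h10
    exact ENNReal.ofReal_add (by positivity) h10
  -- Cancelling the tail of `c X` requires it to be finite; this is where the hypothesis `hfin`
  -- enters.
  refine (ENNReal.add_right_inj (ne_of_lt ?_)).1 h5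
  calc ∫⁻ ω in A, ∫⁻ s in Ioi t, ENNReal.ofReal (c * X s ω) ∂leb ∂P
      ≤ ∫⁻ ω, ∫⁻ s, ENNReal.ofReal (c * X s ω) ∂leb ∂P :=
        (setLIntegral_le_lintegral _ _).trans (lintegral_mono fun _ => setLIntegral_le_lintegral _ _)
    _ = ENNReal.ofReal c * ∫⁻ ω, ∫⁻ s, ENNReal.ofReal (X s ω) ∂leb ∂P := by
        have hm := measurable_lintegral_section hXm univ
        simp only [Measure.restrict_univ] at hm
        simp_rw [ENNReal.ofReal_mul hc]
        rw [← lintegral_const_mul _ hm]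
        refine lintegral_congr fun ω => lintegral_const_mul _ ?_
        exact measurable_section (measurable_uncurry_ofReal hXm) ω
    _ < ∞ := ENNReal.mul_lt_top ENNReal.ofReal_lt_top hfin

/-! ### Pointwise estimates for the driver -/

/-- Bernoulli's inequality for non-positive exponents, from `exp z ≥ 1 + z` and `log y ≤ y - 1`. -/
theorem rpow_tangent_le {ρ y : ℝ} (hρ : ρ ≤ 0) (hy : 0 < y) : 1 + ρ * (y - 1) ≤ y ^ ρ := by
  rw [Real.rpow_def_of_pos hy]
  have h1 := Real.add_one_le_exp (Real.log y * ρ)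
  have h2 := mul_le_mul_of_nonpos_left (Real.log_le_sub_one_of_pos hy) hρ
  linarith

/-- For `ρ < 0` the slope of `U w ^ ρ` is at least `ρ u₂ lo ^ (ρ - 1)` above `lo * I`, and `c`
compensates it. The tangent line at `w` replaces differentiation. -/
theorem driver_mono {ρ U I lo u₂ c w w' : ℝ} (hI : 0 < I) (hU : 0 < U) (hlo : 0 < lo)
    (hu : U * I ^ ρ ≤ u₂ * I) (hc0 : 0 ≤ c) (hc : -ρ * (u₂ * lo ^ (ρ - 1)) ≤ c)
    (hw : lo * I ≤ w) (hww : w ≤ w') : U * w ^ ρ + c * w ≤ U * w' ^ ρ + c * w' := by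
  have hw0 : 0 < w := (mul_pos hlo hI).trans_le hw
  rcases le_or_gt 0 ρ with h | h
  · have := Real.rpow_le_rpow hw0.le hww h
    gcongr
  · have h1 : U * w ^ (ρ - 1) ≤ u₂ * lo ^ (ρ - 1) := by
      have h2 : w ^ (ρ - 1) ≤ (lo * I) ^ (ρ - 1) :=
        Real.rpow_le_rpow_of_nonpos (mul_pos hlo hI) hw (by linarith)
      have h3 : U * I ^ (ρ - 1) ≤ u₂ := by
        rw [Real.rpow_sub_one hI.ne', ← mul_div_assoc, div_le_iff₀ hI]
        exact hu
      calc U * w ^ (ρ - 1) ≤ U * (lo * I) ^ (ρ - 1) := by gcongr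
        _ = (U * I ^ (ρ - 1)) * lo ^ (ρ - 1) := by rw [Real.mul_rpow hlo.le hI.le]; ring
        _ ≤ _ := by gcongr
    have h4 : w' ^ ρ = w ^ ρ * (w' / w) ^ ρ := by
      rw [← Real.mul_rpow hw0.le (div_pos (hw0.trans_le hww) hw0).le, mul_div_cancel₀ _ hw0.ne']
    have h5 := rpow_tangent_le h.le (div_pos (hw0.trans_le hww) hw0)
    have h6 : w ^ ρ + ρ * w ^ (ρ - 1) * (w' - w) ≤ w' ^ ρ := by
      have h7 : w ^ ρ * (1 + ρ * (w' / w - 1)) = w ^ ρ + ρ * w ^ (ρ - 1) * (w' - w) := by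
        rw [Real.rpow_sub_one hw0.ne']
        field_simp
      rw [h4, ← h7]
      gcongr
    have h8 : U * (w ^ ρ + ρ * w ^ (ρ - 1) * (w' - w)) ≤ U * w' ^ ρ := by gcongr
    have h9 : -ρ * (U * w ^ (ρ - 1)) * (w' - w) ≤ c * (w' - w) :=
      mul_le_mul_of_nonneg_right
        ((mul_le_mul_of_nonneg_left h1 (by linarith)).trans hc) (by linarith)
    linarith

/-- The terms `U w ^ ρ`, `e` and `c w` have elasticities at most `max ρ 0`, `0` and `1`. As `c w` is
at most `r` times the first term, the total elasticity is at most the average of `max ρ 0` and `1`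
with weights `1` and `r`. -/
theorem driver_elastic {ρ U r c w x e : ℝ} (hρ : ρ < 1) (hU : 0 < U) (hw : 0 < w) (hx : 0 ≤ x)
    (hr : 0 ≤ r) (he : 0 ≤ e) (hc : c * w ≤ r * (U * w ^ ρ)) :
    U * ((1 + x) * w) ^ ρ + e + c * ((1 + x) * w) ≤
      (1 + (max ρ 0 + r) / (1 + r) * x) * (U * w ^ ρ + e + c * w) := by
  set q := max ρ 0
  have hq0 : 0 ≤ q := le_max_right _ _
  have hq1 : q < 1 := max_lt hρ one_pos
  have h1 : (1 + x) ^ ρ ≤ 1 + q * x :=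
    calc (1 + x) ^ ρ ≤ (1 + x) ^ q :=
          Real.rpow_le_rpow_of_exponent_le (by linarith) (le_max_left _ _)
      _ ≤ 1 + q * x := rpow_one_add_le_one_add_mul_self (by linarith) hq0 hq1.le
  set κ := (q + r) / (1 + r)
  have hκ : κ * (1 + r) = q + r := div_mul_cancel₀ _ (by linarith)
  have hκ0 : 0 ≤ κ := by positivity
  have hκ1 : κ ≤ 1 := by rw [div_le_one (by linarith)]; linarith
  have hV : 0 ≤ U * w ^ ρ := by positivity
  rw [Real.mul_rpow (by linarith) hw.le]
  have h2 : U * ((1 + x) ^ ρ * w ^ ρ) ≤ (1 + q * x) * (U * w ^ ρ) := by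
    calc U * ((1 + x) ^ ρ * w ^ ρ) = (1 + x) ^ ρ * (U * w ^ ρ) := by ring
      _ ≤ _ := by gcongr
  have h3 : (1 - κ) * x * (c * w) ≤ (1 - κ) * x * (r * (U * w ^ ρ)) :=
    mul_le_mul_of_nonneg_left hc (mul_nonneg (by linarith) hx)
  have h4 : 0 ≤ κ * x * e := by positivity
  have h5 : (1 - κ) * r = κ - q := by linarith
  have h6 : (1 - κ) * x * (r * (U * w ^ ρ)) = (κ - q) * x * (U * w ^ ρ) := by
    rw [← h5]; ring
  linarith

/-- Supplies the `r` of `driver_elastic`: below `hi * I` one has `w ^ (1 - ρ) ≤ hi ^ (1 - ρ) * U /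
u₁`. -/
theorem mul_le_mul_driver {ρ U I u₁ hi c w : ℝ} (hρ : ρ < 1) (hI : 0 < I) (hu₁ : 0 < u₁)
    (hu : u₁ * I ≤ U * I ^ ρ) (hc : 0 ≤ c) (hw : 0 < w) (hhi : 0 < hi) (hwI : w ≤ hi * I) :
    c * w ≤ c * hi ^ (1 - ρ) / u₁ * (U * w ^ ρ) := by
  have h1 : w = w ^ ρ * w ^ (1 - ρ) := by
    rw [← Real.rpow_add hw, add_sub_cancel, Real.rpow_one]
  have h2 : w ^ (1 - ρ) ≤ hi ^ (1 - ρ) * I ^ (1 - ρ) := by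
    rw [← Real.mul_rpow hhi.le hI.le]
    exact Real.rpow_le_rpow hw.le hwI (by linarith)
  have h3 : I ^ (1 - ρ) ≤ U / u₁ := by
    rw [Real.rpow_sub hI, Real.rpow_one, div_le_div_iff₀ (Real.rpow_pos_of_pos hI _) hu₁]
    linarith
  calc c * w = c * w ^ ρ * w ^ (1 - ρ) := by rw [mul_assoc, ← h1]
    _ ≤ c * w ^ ρ * (hi ^ (1 - ρ) * (U / u₁)) := by gcongr; exact h2.trans (by gcongr)
    _ = _ := by ring

/-! ### Progressive measurability of the driver -/

theorem isStronglyProgressive_comp {X : ℝ≥0 → Ω → ℝ} (hX : IsStronglyProgressive 𝓕 X) {φ : ℝ → ℝ}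
    (hφ : Measurable φ) : IsStronglyProgressive 𝓕 fun t ω => φ (X t ω) :=
  fun i => (hφ.comp (hX i).measurable).stronglyMeasurable

theorem isStronglyProgressive_time {φ : ℝ≥0 → ℝ} (hφ : Measurable φ) :
    IsStronglyProgressive 𝓕 fun t (_ : Ω) => φ t :=
  fun i => ((hφ.comp measurable_subtype_coe).comp
    (@measurable_fst _ _ _ (𝓕 i))).stronglyMeasurable

/-- The integrand of the perturbed operator. -/
noncomputable def driver (ρ ε : ℝ) (U a W : ℝ≥0 → Ω → ℝ) : ℝ≥0 → Ω → ℝ :=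
  fun s ω => U s ω * W s ω ^ ρ + ε * a s ω

theorem isStronglyProgressive_driver {ρ ε : ℝ} {U a W : ℝ≥0 → Ω → ℝ}
    (hU : IsStronglyProgressive 𝓕 U) (ha : IsStronglyProgressive 𝓕 a)
    (hW : IsStronglyProgressive 𝓕 W) : IsStronglyProgressive 𝓕 (driver ρ ε U a W) :=
  (hU.mul (isStronglyProgressive_comp hW (measurable_id.pow_const ρ))).add
    (isStronglyProgressive_comp ha (measurable_id.const_mul ε))

theorem isStronglyProgressive_discount {f : ℝ≥0 → Ω → ℝ} (hf : IsStronglyProgressive 𝓕 f) (c : ℝ) :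
    IsStronglyProgressive 𝓕 fun s ω => Real.exp (c * s) * f s ω :=
  (isStronglyProgressive_time (measurable_exp_mul c)).mul hf

theorem IsTail.const_mul {X f : ℝ≥0 → Ω → ℝ} (hX : IsTail 𝓕 P X f)
    (hf : Measurable (Function.uncurry f)) {c : ℝ} (hc : 0 ≤ c) :
    IsTail 𝓕 P (fun t ω => c * X t ω) (fun t ω => c * f t ω) := by
  refine ⟨fun t => (hX.1 t).const_mul c, fun t A hA => ?_⟩
  simp_rw [ENNReal.ofReal_mul hc]
  rw [lintegral_const_mul _ (((hX.1 t).measurable.mono (𝓕.le t) le_rfl).ennreal_ofReal),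
    hX.2 t A hA, ← lintegral_const_mul _ (measurable_lintegral_section hf _)]
  refine lintegral_congr fun ω => ?_
  rw [← lintegral_const_mul _ (measurable_section (measurable_uncurry_ofReal hf) ω)]

/-! ### The fixed point -/

/-- The weight `U` and the terminal density `a` are comparable with the conditional tail integral
`I` of `a`, in the sense required for `W ↦ U W ^ ρ` to preserve the order class of `I`. -/
structure Comparable (𝓕 : Filtration ℝ≥0 m) (P : Measure Ω) (ρ : ℝ) (a I U : ℝ≥0 → Ω → ℝ)
    (k K u₁ u₂ : ℝ) : Prop where
  rho_lt : ρ < 1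
  k_pos : 0 < k
  K_pos : 0 < K
  u₁_pos : 0 < u₁
  prog_a : IsStronglyProgressive 𝓕 a
  prog_I : IsStronglyProgressive 𝓕 I
  prog_U : IsStronglyProgressive 𝓕 U
  tail : IsTail 𝓕 P I a
  fin : ∫⁻ ω, ∫⁻ s, ENNReal.ofReal (a s ω) ∂leb ∂P < ∞
  I_pos : ∀ t, ∀ᵐ ω ∂P, 0 < I t ω
  a_bound : ∀ t, ∀ᵐ ω ∂P, k * I t ω ≤ a t ω ∧ a t ω ≤ K * I t ω
  U_bound : ∀ t, ∀ᵐ ω ∂P, u₁ * I t ω ≤ U t ω * I t ω ^ ρ ∧ U t ω * I t ω ^ ρ ≤ u₂ * I t ω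

namespace Comparable

variable {ρ ε k K u₁ u₂ lo hi c : ℝ} {a I U W V W' V' : ℝ≥0 → Ω → ℝ}

theorem ae_pos (h : Comparable 𝓕 P ρ a I U k K u₁ u₂) (t : ℝ≥0) :
    ∀ᵐ ω ∂P, 0 < I t ω ∧ 0 < a t ω ∧ 0 < U t ω := by
  filter_upwards [h.I_pos t, h.a_bound t, h.U_bound t] with ω h1 h2 h3
  exact ⟨h1, (mul_pos h.k_pos h1).trans_le h2.1, pos_of_mul_pos_left
    ((mul_pos h.u₁_pos h1).trans_le h3.1) (Real.rpow_nonneg h1.le _)⟩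

/-- Integrability of anything of order `I` reduces to that of `a`, since `I ≤ a / k`. -/
theorem lintegral_lt_top [SFinite P] (h : Comparable 𝓕 P ρ a I U k K u₁ u₂) {f : ℝ≥0 → Ω → ℝ}
    (hf : Measurable (Function.uncurry f)) {C : ℝ} (hC : 0 ≤ C)
    (hfC : ∀ t, ∀ᵐ ω ∂P, f t ω ≤ C * I t ω) :
    ∫⁻ ω, ∫⁻ s, ENNReal.ofReal (f s ω) ∂leb ∂P < ∞ := by
  have ha := measurable_uncurry_of_progressive h.prog_a
  have h1 : ∫⁻ ω, ∫⁻ s, ENNReal.ofReal (f s ω) ∂leb ∂P ≤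
      ∫⁻ ω, ∫⁻ s, ENNReal.ofReal (C / k) * ENNReal.ofReal (a s ω) ∂leb ∂P := by
    have h2 := lintegral_tail_mono (P := P) (measurable_uncurry_ofReal hf)
      (g := fun s ω => ENNReal.ofReal (C / k) * ENNReal.ofReal (a s ω))
      ((measurable_uncurry_ofReal ha).const_mul _) (fun s => ?_) univ univ
    · simpa only [Measure.restrict_univ] using h2
    · filter_upwards [hfC s, h.a_bound s] with ω h3 h4
      rw [← ENNReal.ofReal_mul (div_nonneg hC h.k_pos.le)]
      refine ENNReal.ofReal_le_ofReal (h3.trans ?_)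
      calc C * I s ω = C / k * (k * I s ω) := by field_simp [h.k_pos.ne']
        _ ≤ _ := mul_le_mul_of_nonneg_left h4.1 (div_nonneg hC h.k_pos.le)
  refine h1.trans_lt ?_
  have hm := measurable_lintegral_section ha univ
  simp only [Measure.restrict_univ] at hm
  have h5 : ∀ ω, ∫⁻ s, ENNReal.ofReal (C / k) * ENNReal.ofReal (a s ω) ∂leb =
      ENNReal.ofReal (C / k) * ∫⁻ s, ENNReal.ofReal (a s ω) ∂leb := fun ω =>
    lintegral_const_mul _ (measurable_section (measurable_uncurry_ofReal ha) ω)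
  simp_rw [h5]
  rw [lintegral_const_mul _ hm]
  exact ENNReal.mul_lt_top ENNReal.ofReal_lt_top h.fin

/-- The contraction estimate: if `W ≤ (1 + x) V`, then the image of `W` under the discounted
operator is at most `1 + κ x` times the image of `V`. -/
theorem step_le [IsFiniteMeasure P] (h : Comparable 𝓕 P ρ a I U k K u₁ u₂) (hε : 0 ≤ ε)
    (hlo : 0 < lo) (hhi : 0 < hi) (hc0 : 0 ≤ c) (hc : -ρ * (u₂ * lo ^ (ρ - 1)) ≤ c)
    (hW : IsStronglyProgressive 𝓕 W) (hV : IsStronglyProgressive 𝓕 V)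
    (hWI : ∀ t, ∀ᵐ ω ∂P, lo * I t ω ≤ W t ω)
    (hVI : ∀ t, ∀ᵐ ω ∂P, lo * I t ω ≤ V t ω ∧ V t ω ≤ hi * I t ω)
    (hW' : IsTail 𝓕 P (fun t ω => Real.exp (-c * t) * W' t ω)
      (fun t ω => Real.exp (-c * t) * (driver ρ ε U a W t ω + c * W t ω)))
    (hV' : IsTail 𝓕 P (fun t ω => Real.exp (-c * t) * V' t ω)
      (fun t ω => Real.exp (-c * t) * (driver ρ ε U a V t ω + c * V t ω)))
    (hV'0 : ∀ t, ∀ᵐ ω ∂P, 0 ≤ V' t ω) {x : ℝ} (hx : 0 ≤ x)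
    (hWV : ∀ t, ∀ᵐ ω ∂P, W t ω ≤ (1 + x) * V t ω) (t : ℝ≥0) :
    ∀ᵐ ω ∂P, W' t ω ≤ (1 + (max ρ 0 + c * hi ^ (1 - ρ) / u₁) /
      (1 + c * hi ^ (1 - ρ) / u₁) * x) * V' t ω := by
  set r := c * hi ^ (1 - ρ) / u₁
  have hr : 0 ≤ r := div_nonneg (by positivity) h.u₁_pos.le
  set κ := (max ρ 0 + r) / (1 + r)
  have hκ : 0 ≤ 1 + κ * x := by
    have : 0 ≤ max ρ 0 := le_max_right _ _
    positivity
  have hmeas : ∀ {W : ℝ≥0 → Ω → ℝ}, IsStronglyProgressive 𝓕 W → Measurable (Function.uncurry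
      fun (t : ℝ≥0) ω => Real.exp (-c * t) * (driver ρ ε U a W t ω + c * W t ω)) := fun hW =>
    measurable_uncurry_of_progressive (isStronglyProgressive_discount
      ((isStronglyProgressive_driver h.prog_U h.prog_a hW).add
        (isStronglyProgressive_comp hW (measurable_id.const_mul c))) (-c))
  have h1 := hW'.le (hV'.const_mul (hmeas hV) hκ) (hmeas hW) ((hmeas hV).const_mul _)
    (fun t => (hV'0 t).mono fun ω h2 => mul_nonneg hκ (mul_nonneg (Real.exp_pos _).le h2))
    (fun s => ?_) t
  · filter_upwards [h1] with ω h2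
    refine le_of_mul_le_mul_left ?_ (Real.exp_pos (-c * t))
    linarith
  · filter_upwards [h.ae_pos s, h.U_bound s, hWI s, hVI s, hWV s] with ω ⟨hI, ha, hU⟩ h3 h4 h5 h6
    have hV0 : 0 < V s ω := (mul_pos hlo hI).trans_le h5.1
    -- First raise `W` to `(1 + x) V` by monotonicity, then extract the factor by elasticity.
    have h7 := driver_mono hI hU hlo h3.2 hc0 hc h4 h6
    have h8 := driver_elastic h.rho_lt hU hV0 hx hr (mul_nonneg hε ha.le)
      (mul_le_mul_driver h.rho_lt hI h.u₁_pos h3.1 hc0 hV0 hhi h5.2)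
    rw [mul_left_comm]
    refine mul_le_mul_of_nonneg_left ?_ (Real.exp_pos _).le
    simp only [driver]
    linarith

theorem rate_lt_one {r : ℝ} (hρ : ρ < 1) (hr : 0 ≤ r) :
    0 ≤ (max ρ 0 + r) / (1 + r) ∧ (max ρ 0 + r) / (1 + r) < 1 := by
  have h0 : 0 ≤ max ρ 0 := le_max_right _ _
  have h1 : max ρ 0 < 1 := max_lt hρ one_pos
  refine ⟨by positivity, ?_⟩
  rw [div_lt_one (by linarith)]
  linarith

theorem ae_le_of_forall_pow {W V : Ω → ℝ} {κ x : ℝ} (hκ : 0 ≤ κ) (hκ1 : κ < 1)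
    (h : ∀ n : ℕ, ∀ᵐ ω ∂P, W ω ≤ (1 + κ ^ n * x) * V ω) : ∀ᵐ ω ∂P, W ω ≤ V ω := by
  filter_upwards [ae_all_iff.2 h] with ω hω
  have h1 : Tendsto (fun n : ℕ => (1 + κ ^ n * x) * V ω) atTop (𝓝 ((1 + 0 * x) * V ω)) :=
    (((tendsto_pow_atTop_nhds_zero_of_lt_one hκ hκ1).mul_const x).const_add 1).mul_const _
  simpa using ge_of_tendsto' h1 hω

theorem le_mul_of_bounds (hlo : 0 < lo) {I w v : ℝ} (hI : 0 < I) (hhi : 0 < hi) (h1 : w ≤ hi * I)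
    (h2 : lo * I ≤ v) : w ≤ (1 + hi / lo) * v :=
  calc w ≤ hi * I := h1
    _ = hi / lo * (lo * I) := by field_simp
    _ ≤ hi / lo * v := by gcongr
    _ ≤ _ := by have := (mul_pos hlo hI).trans_le h2; linarith

theorem driver_nonneg (h : Comparable 𝓕 P ρ a I U k K u₁ u₂) (hε : 0 ≤ ε)
    (hlo : 0 < lo) (hWI : ∀ t, ∀ᵐ ω ∂P, lo * I t ω ≤ W t ω) (t : ℝ≥0) :
    ∀ᵐ ω ∂P, 0 < W t ω ∧ 0 ≤ driver ρ ε U a W t ω := by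
  filter_upwards [h.ae_pos t, hWI t] with ω ⟨h1, h2, h3⟩ h4
  have h5 := (mul_pos hlo h1).trans_le h4
  exact ⟨h5, add_nonneg (mul_nonneg h3.le (Real.rpow_nonneg h5.le _)) (mul_nonneg hε h2.le)⟩

/-- Fixed points are also fixed by the discounted operator, so `step_le` applies with `W' = W` and
`V' = V`. It improves the crude ratio `1 + hi / lo` to `1 + κ ^ n * (hi / lo)` for every `n`. -/
theorem fixedPoint_le [IsFiniteMeasure P] (h : Comparable 𝓕 P ρ a I U k K u₁ u₂) (hε : 0 ≤ ε)
    (hlo : 0 < lo) (hhi : 0 < hi) (hW : IsStronglyProgressive 𝓕 W)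
    (hV : IsStronglyProgressive 𝓕 V)
    (hWI : ∀ t, ∀ᵐ ω ∂P, lo * I t ω ≤ W t ω ∧ W t ω ≤ hi * I t ω)
    (hVI : ∀ t, ∀ᵐ ω ∂P, lo * I t ω ≤ V t ω ∧ V t ω ≤ hi * I t ω)
    (hWT : IsTail 𝓕 P W (driver ρ ε U a W)) (hVT : IsTail 𝓕 P V (driver ρ ε U a V)) (t : ℝ≥0) :
    ∀ᵐ ω ∂P, W t ω ≤ V t ω := by
  set c := max 0 (-ρ * (u₂ * lo ^ (ρ - 1)))
  have hc0 : 0 ≤ c := le_max_left _ _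
  have hc : -ρ * (u₂ * lo ^ (ρ - 1)) ≤ c := le_max_right _ _
  obtain ⟨hκ0, hκ1⟩ := rate_lt_one (r := c * hi ^ (1 - ρ) / u₁) h.rho_lt
    (div_nonneg (by positivity) h.u₁_pos.le)
  have hd : ∀ {W : ℝ≥0 → Ω → ℝ}, IsStronglyProgressive 𝓕 W →
      (∀ t, ∀ᵐ ω ∂P, lo * I t ω ≤ W t ω ∧ W t ω ≤ hi * I t ω) →
      IsTail 𝓕 P W (driver ρ ε U a W) → IsTail 𝓕 P (fun t ω => Real.exp (-c * t) * W t ω)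
      (fun t ω => Real.exp (-c * t) * (driver ρ ε U a W t ω + c * W t ω)) := by
    intro W hW hWI hWT
    have hn := h.driver_nonneg hε hlo fun t => (hWI t).mono fun ω h => h.1
    exact hWT.discount hc0 (measurable_uncurry_of_progressive hW)
      (measurable_uncurry_of_progressive (isStronglyProgressive_driver h.prog_U h.prog_a hW))
      (fun t => (hn t).mono fun ω h => h.1.le) (fun t => (hn t).mono fun ω h => h.2)
  have hV0 : ∀ t, ∀ᵐ ω ∂P, 0 ≤ V t ω := fun t =>
    (h.driver_nonneg hε hlo (fun t => (hVI t).mono fun ω h => h.1) t).mono fun ω h => h.1.le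
  refine ae_le_of_forall_pow (x := hi / lo) hκ0 hκ1 fun n => ?_
  induction n generalizing t with
  | zero =>
    filter_upwards [h.I_pos t, hWI t, hVI t] with ω h1 h2 h3
    simpa using le_mul_of_bounds hlo h1 hhi h2.2 h3.1
  | succ n ih =>
    have h1 := h.step_le hε hlo hhi hc0 hc hW hV (fun t => (hWI t).mono fun ω h => h.1) hVI
      (hd hW hWI hWT) (hd hV hVI hVT) hV0 (by positivity) ih t
    rw [pow_succ', mul_assoc]
    exact h1

/-- Existence of the image of `W` under the discounted operator. -/
theorem exists_step [IsProbabilityMeasure P] (hUs : UsualConditions 𝓕 P)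
    (h : Comparable 𝓕 P ρ a I U k K u₁ u₂) (hε : 0 ≤ ε)
    (hlo : 0 < lo) (hhi : 0 < hi) (hc0 : 0 ≤ c) (hc : -ρ * (u₂ * lo ^ (ρ - 1)) ≤ c)
    (hlo' : lo * K ≤ lo ^ ρ * u₁) (hhi' : hi ^ ρ * u₂ + ε * k ≤ hi * k)
    (hW : IsStronglyProgressive 𝓕 W)
    (hWI : ∀ t, ∀ᵐ ω ∂P, lo * I t ω ≤ W t ω ∧ W t ω ≤ hi * I t ω) :
    ∃ W' : ℝ≥0 → Ω → ℝ, IsTail 𝓕 P (fun t ω => Real.exp (-c * t) * W' t ω)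
      (fun t ω => Real.exp (-c * t) * (driver ρ ε U a W t ω + c * W t ω)) ∧
      StronglyAdapted 𝓕 W' ∧ (∀ ω, IsCadlag fun t => W' t ω) ∧ (∀ t ω, 0 ≤ W' t ω) ∧
      ∀ t, ∀ᵐ ω ∂P, lo * I t ω ≤ W' t ω ∧ W' t ω ≤ hi * I t ω := by
  have hfp : IsStronglyProgressive 𝓕
      fun (t : ℝ≥0) ω => Real.exp (-c * t) * (driver ρ ε U a W t ω + c * W t ω) :=
    isStronglyProgressive_discount
      ((isStronglyProgressive_driver h.prog_U h.prog_a hW).add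
        (isStronglyProgressive_comp hW (measurable_id.const_mul c))) (-c)
  have hfm := measurable_uncurry_of_progressive hfp
  -- The discounted `hi * I` is the tail of the discounted right-hand side, so this gives the upper
  -- edge of the band for the image; `hlower` gives the lower edge.
  have hupper : ∀ t, ∀ᵐ ω ∂P, driver ρ ε U a W t ω + c * W t ω ≤ hi * (a t ω + c * I t ω) := by
    intro t
    filter_upwards [h.ae_pos t, h.a_bound t, h.U_bound t, hWI t] with ω ⟨hI, ha, hU⟩ h1 h2 h3
    have h4 := driver_mono hI hU hlo h2.2 hc0 hc h3.1 h3.2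
    have h5 : U t ω * (hi * I t ω) ^ ρ ≤ hi ^ ρ * u₂ * I t ω := by
      rw [Real.mul_rpow hhi.le hI.le]
      calc U t ω * (hi ^ ρ * I t ω ^ ρ) = hi ^ ρ * (U t ω * I t ω ^ ρ) := by ring
        _ ≤ hi ^ ρ * (u₂ * I t ω) := mul_le_mul_of_nonneg_left h2.2 (by positivity)
        _ = _ := by ring
    have hεhi : ε ≤ hi := by
      have hu₂ : 0 ≤ u₂ := by
        have := (mul_pos h.u₁_pos hI).trans_le (h2.1.trans h2.2)
        exact (pos_of_mul_pos_left this hI.le).le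
      refine le_of_mul_le_mul_right ?_ h.k_pos
      have : 0 ≤ hi ^ ρ * u₂ := by positivity
      linarith
    have h6 : hi ^ ρ * u₂ * I t ω ≤ (hi - ε) * a t ω :=
      calc hi ^ ρ * u₂ * I t ω ≤ (hi - ε) * k * I t ω :=
            mul_le_mul_of_nonneg_right (by linarith) hI.le
        _ = (hi - ε) * (k * I t ω) := by ring
        _ ≤ _ := mul_le_mul_of_nonneg_left h1.1 (by linarith)
    simp only [driver]
    linarith
  have hlower : ∀ t, ∀ᵐ ω ∂P, lo * (a t ω + c * I t ω) ≤ driver ρ ε U a W t ω + c * W t ω := by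
    intro t
    filter_upwards [h.ae_pos t, h.a_bound t, h.U_bound t, hWI t] with ω ⟨hI, ha, hU⟩ h1 h2 h3
    have h4 := driver_mono hI hU hlo h2.2 hc0 hc le_rfl h3.1
    have h5 : lo * a t ω ≤ U t ω * (lo * I t ω) ^ ρ := by
      rw [Real.mul_rpow hlo.le hI.le]
      calc lo * a t ω ≤ lo * (K * I t ω) := by gcongr; exact h1.2
        _ = lo * K * I t ω := by ring
        _ ≤ lo ^ ρ * u₁ * I t ω := by gcongr
        _ = lo ^ ρ * (u₁ * I t ω) := by ring
        _ ≤ lo ^ ρ * (U t ω * I t ω ^ ρ) := mul_le_mul_of_nonneg_left h2.1 (by positivity)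
        _ = _ := by ring
    have h6 : 0 ≤ ε * a t ω := mul_nonneg hε ha.le
    simp only [driver]
    linarith
  have hfin : ∫⁻ ω, ∫⁻ s : ℝ≥0, ENNReal.ofReal (Real.exp (-c * s) *
      (driver ρ ε U a W s ω + c * W s ω)) ∂leb ∂P < ∞ := by
    have hC : 0 ≤ hi * (K + c) := mul_nonneg hhi.le (add_nonneg h.K_pos.le hc0)
    refine h.lintegral_lt_top hfm hC fun t => ?_
    filter_upwards [h.ae_pos t, h.a_bound t, hupper t] with ω ⟨hI, ha, hU⟩ h1 h2
    have h3 : Real.exp (-c * t) ≤ 1 := by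
      rw [Real.exp_le_one_iff, neg_mul, neg_nonpos]
      positivity
    calc Real.exp (-c * t) * (driver ρ ε U a W t ω + c * W t ω)
        ≤ Real.exp (-c * t) * (hi * (a t ω + c * I t ω)) := by gcongr
      _ ≤ 1 * (hi * (a t ω + c * I t ω)) := by gcongr
      _ ≤ 1 * (hi * (K * I t ω + c * I t ω)) := by gcongr; exact h1.2
      _ = _ := by ring
  obtain ⟨X, hX, hXc, hX0⟩ := exists_cadlag_isTail hUs hfp hfin
  have hcancel : ∀ (t : ℝ≥0) (y : ℝ), Real.exp (-c * t) * (Real.exp (c * t) * y) = y := by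
    intro t y
    rw [← mul_assoc, ← Real.exp_add]
    simp
  have hIT := (h.tail.discount hc0 (measurable_uncurry_of_progressive h.prog_I)
    (measurable_uncurry_of_progressive h.prog_a) (fun t => (h.I_pos t).mono fun ω h => h.le)
    (fun t => (h.ae_pos t).mono fun ω h => h.2.1.le))
  have hIm : Measurable (Function.uncurry fun (t : ℝ≥0) ω =>
      Real.exp (-c * t) * (a t ω + c * I t ω)) :=
    measurable_uncurry_of_progressive (isStronglyProgressive_discount (h.prog_a.add
        (isStronglyProgressive_comp h.prog_I (measurable_id.const_mul c))) (-c))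
  have hT : IsTail 𝓕 P (fun t ω => Real.exp (-c * t) * (Real.exp (c * t) * X t ω))
      (fun t ω => Real.exp (-c * t) * (driver ρ ε U a W t ω + c * W t ω)) := by
    simp_rw [hcancel]
    exact hX
  refine ⟨fun t ω => Real.exp (c * t) * X t ω, hT, fun t => (hX.1 t).const_mul _, fun ω => ?_,
    fun t ω => mul_nonneg (Real.exp_pos _).le (hX0 t ω), fun t => ?_⟩
  · exact (isCadlag_of_continuous (x := fun t : ℝ≥0 => Real.exp (c * t))
      (by fun_prop)).comp_continuous₂ (hXc ω) (φ := fun x y => x * y) (by fun_prop)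
  · have h1 := (hIT.const_mul hIm hlo.le).le hX (hIm.const_mul _) hfm
      (fun t => Eventually.of_forall (hX0 t)) (fun s => by
        filter_upwards [hlower s] with ω h1
        rw [mul_left_comm]
        exact mul_le_mul_of_nonneg_left h1 (Real.exp_pos _).le) t
    have h2 := hX.le (hIT.const_mul hIm hhi.le) hfm (hIm.const_mul _)
      (fun t => (h.I_pos t).mono fun ω h =>
        mul_nonneg hhi.le (mul_nonneg (Real.exp_pos _).le h.le)) (fun s => by
        filter_upwards [hupper s] with ω h1
        rw [mul_left_comm hi]
        exact mul_le_mul_of_nonneg_left h1 (Real.exp_pos _).le) t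
    filter_upwards [h1, h2] with ω h3 h4
    constructor
    · refine le_of_mul_le_mul_left ?_ (Real.exp_pos (-c * t))
      rw [hcancel]
      linarith
    · refine le_of_mul_le_mul_left ?_ (Real.exp_pos (-c * t))
      rw [hcancel]
      linarith

/-- Both conditions hold because `ρ < 1`: `lo` solves `lo ^ (ρ - 1) = K / u₁`, so the first is an
equality, and a large `hi` makes `hi ^ (ρ - 1) * u₂ ≤ k / 2` and `ε ≤ hi / 2`. -/
theorem exists_bounds (h : Comparable 𝓕 P ρ a I U k K u₁ u₂) :
    ∃ lo hi : ℝ, 0 < lo ∧ lo ≤ hi ∧ lo * K ≤ lo ^ ρ * u₁ ∧ hi ^ ρ * u₂ + ε * k ≤ hi * k := by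
  have hρ := h.rho_lt
  have hq : 0 < K / u₁ := div_pos h.K_pos h.u₁_pos
  set lo : ℝ := (K / u₁) ^ (1 / (ρ - 1))
  have hlo : 0 < lo := Real.rpow_pos_of_pos hq _
  have h1 : lo ^ (ρ - 1) = K / u₁ := by
    rw [← Real.rpow_mul hq.le, one_div_mul_cancel (by linarith), Real.rpow_one]
  have h2 : Tendsto (fun x : ℝ => x ^ (-(1 - ρ)) * u₂) atTop (𝓝 (0 * u₂)) :=
    (tendsto_rpow_neg_atTop (by linarith)).mul_const _
  rw [zero_mul] at h2
  obtain ⟨hi, h3, h4, h5⟩ := ((h2.eventually_le_const (half_pos h.k_pos)).and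
    ((eventually_ge_atTop lo).and (eventually_ge_atTop (2 * ε)))).exists
  have hhi : 0 < hi := hlo.trans_le h4
  refine ⟨lo, hi, hlo, h4, ?_, ?_⟩
  · have h6 : lo ^ ρ = lo * (K / u₁) := by
      rw [← h1, Real.rpow_sub_one hlo.ne']
      field_simp
    rw [h6, mul_assoc, div_mul_cancel₀ _ h.u₁_pos.ne']
  · have h6 : hi ^ ρ = hi * hi ^ (-(1 - ρ)) := by
      rw [neg_sub, Real.rpow_sub_one hhi.ne']
      field_simp
    have h7 := mul_le_mul_of_nonneg_left h3 hhi.le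
    have h8 := mul_le_mul_of_nonneg_right h5 h.k_pos.le
    rw [h6]
    linarith

/-- Existence of a càdlàg fixed point of the same order as `I`. -/
theorem exists_fixedPoint [IsProbabilityMeasure P] (hUs : UsualConditions 𝓕 P)
    (h : Comparable 𝓕 P ρ a I U k K u₁ u₂) (hε : 0 ≤ ε) :
    ∃ W : ℝ≥0 → Ω → ℝ, IsTail 𝓕 P W (driver ρ ε U a W) ∧ (∀ ω, IsCadlag fun t => W t ω) ∧
      (∀ t ω, 0 ≤ W t ω) ∧ ∃ lo hi : ℝ, 0 < lo ∧ 0 < hi ∧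
      ∀ t, ∀ᵐ ω ∂P, lo * I t ω ≤ W t ω ∧ W t ω ≤ hi * I t ω := by
  obtain ⟨lo, hi, hlo, hlohi, hlo', hhi'⟩ := h.exists_bounds (ε := ε)
  have hhi : 0 < hi := hlo.trans_le hlohi
  set c := max 0 (-ρ * (u₂ * lo ^ (ρ - 1)))
  have hc0 : 0 ≤ c := le_max_left _ _
  have hc : -ρ * (u₂ * lo ^ (ρ - 1)) ≤ c := le_max_right _ _
  obtain ⟨hκ0, hκ1⟩ := rate_lt_one (r := c * hi ^ (1 - ρ) / u₁) h.rho_lt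
    (div_nonneg (by positivity) h.u₁_pos.le)
  let S := {W : ℝ≥0 → Ω → ℝ // IsStronglyProgressive 𝓕 W ∧
    ∀ t, ∀ᵐ ω ∂P, lo * I t ω ≤ W t ω ∧ W t ω ≤ hi * I t ω}
  have hstep := fun W : S => h.exists_step hUs hε hlo hhi hc0 hc hlo' hhi' W.2.1 W.2.2
  choose Φ hΦT hΦa hΦc hΦ0 hΦI using hstep
  let next : S → S := fun W => ⟨Φ W, isStronglyProgressive_of_isCadlag (hΦa W) (hΦc W), hΦI W⟩
  let W₀ : S := ⟨fun t ω => lo * I t ω,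
    isStronglyProgressive_comp h.prog_I (measurable_id.const_mul lo), fun t => by
      filter_upwards [h.I_pos t] with ω h1
      exact ⟨le_rfl, by gcongr⟩⟩
  have hnext : ∀ (W V : S) {x : ℝ}, 0 ≤ x → (∀ t, ∀ᵐ ω ∂P, W.1 t ω ≤ (1 + x) * V.1 t ω) →
      ∀ t, ∀ᵐ ω ∂P, (next W).1 t ω ≤ (1 + (max ρ 0 + c * hi ^ (1 - ρ) / u₁) /
      (1 + c * hi ^ (1 - ρ) / u₁) * x) * (next V).1 t ω := fun W V x hx hWV =>
    h.step_le hε hlo hhi hc0 hc W.2.1 V.2.1 (fun t => (W.2.2 t).mono fun ω h => h.1) V.2.2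
      (hΦT W) (hΦT V) (fun t => Eventually.of_forall (hΦ0 V t)) hx hWV
  let Wn : ℕ → S := fun n => next^[n] W₀
  have hWsucc : ∀ n, Wn (n + 1) = next (Wn n) := fun n => Function.iterate_succ_apply' _ _ _
  have hall : ∀ t, ∀ᵐ ω ∂P, ∀ n, lo * I t ω ≤ (Wn n).1 t ω ∧ (Wn n).1 t ω ≤ hi * I t ω :=
    fun t => ae_all_iff.2 fun n => (Wn n).2.2 t
  -- A countable supremum keeps progressive measurability and the band. The iterates need not be
  -- shown to increase.
  let Wsup : S := ⟨fun t ω => ⨆ n, (Wn n).1 t ω,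
    fun i => (Measurable.iSup fun n => ((Wn n).2.1 i).measurable).stronglyMeasurable, fun t => by
      filter_upwards [hall t] with ω h1
      exact ⟨(h1 0).1.trans (le_ciSup (f := fun n => (Wn n).1 t ω)
        ⟨hi * I t ω, by rintro _ ⟨n, rfl⟩; exact (h1 n).2⟩ 0), ciSup_le fun n => (h1 n).2⟩⟩
  have hle_sup : ∀ n t, ∀ᵐ ω ∂P, (Wn n).1 t ω ≤ Wsup.1 t ω := by
    intro n t
    filter_upwards [hall t] with ω h1
    exact le_ciSup (f := fun n => (Wn n).1 t ω)
      ⟨hi * I t ω, by rintro _ ⟨n, rfl⟩; exact (h1 n).2⟩ n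
  have hsup_le : ∀ t, ∀ᵐ ω ∂P, Wsup.1 t ω ≤ (next Wsup).1 t ω := by
    intro t
    have h1 : ∀ n, ∀ᵐ ω ∂P, (Wn n).1 t ω ≤ (next Wsup).1 t ω := by
      intro n
      cases n with
      | zero =>
        filter_upwards [(next Wsup).2.2 t] with ω h2
        exact h2.1
      | succ n =>
        -- With `x = 0` the contraction estimate is plain monotonicity of the discounted operator.
        have h2 := hnext (Wn n) Wsup (x := 0) le_rfl (by simpa using hle_sup n) t
        simpa [hWsucc] using h2
    filter_upwards [ae_all_iff.2 h1] with ω h2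
    exact ciSup_le h2
  set κ := (max ρ 0 + c * hi ^ (1 - ρ) / u₁) / (1 + c * hi ^ (1 - ρ) / u₁)
  have hgeom : ∀ n : ℕ, ∀ t, ∀ᵐ ω ∂P, Wsup.1 t ω ≤ (1 + κ ^ n * (hi / lo)) * (Wn n).1 t ω := by
    intro n
    induction n with
    | zero =>
      intro t
      filter_upwards [h.I_pos t, Wsup.2.2 t, W₀.2.2 t] with ω h1 h2 h3
      rw [pow_zero, one_mul]
      exact le_mul_of_bounds hlo h1 hhi h2.2 h3.1
    | succ n ih =>
      intro t
      filter_upwards [hsup_le t, hnext Wsup (Wn n) (by positivity) ih t] with ω h1 h2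
      rw [hWsucc, pow_succ', mul_assoc]
      exact h1.trans h2
  have hle : ∀ t, ∀ᵐ ω ∂P, (next Wsup).1 t ω ≤ Wsup.1 t ω := by
    intro t
    -- Applying the operator to `hgeom n` compares the image of `Wsup` with `Wn (n + 1)`, hence with
    -- `Wsup`, up to the factor `1 + κ ^ (n + 1) * (hi / lo)`.
    refine ae_le_of_forall_pow (x := κ * (hi / lo)) hκ0 hκ1 fun n => ?_
    filter_upwards [hnext Wsup (Wn n) (by positivity) (hgeom n) t, hle_sup (n + 1) t]
      with ω h1 h2
    rw [← mul_assoc, ← pow_succ, pow_succ', mul_assoc]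
    rw [hWsucc] at h2
    exact h1.trans (mul_le_mul_of_nonneg_left h2 (by positivity))
  have heq : ∀ t, Wsup.1 t =ᵐ[P] Φ Wsup t := fun t => by
    filter_upwards [hsup_le t, hle t] with ω h1 h2 using le_antisymm h1 h2
  have hprog : IsStronglyProgressive 𝓕 (Φ Wsup) := (next Wsup).2.1
  have hmeas : ∀ {W : ℝ≥0 → Ω → ℝ}, IsStronglyProgressive 𝓕 W → Measurable (Function.uncurry
      fun (t : ℝ≥0) ω => Real.exp (-c * t) * (driver ρ ε U a W t ω + c * W t ω)) := fun hW =>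
    measurable_uncurry_of_progressive (isStronglyProgressive_discount
      ((isStronglyProgressive_driver h.prog_U h.prog_a hW).add
        (isStronglyProgressive_comp hW (measurable_id.const_mul c))) (-c))
  -- The fixed point is the càdlàg image `Φ Wsup` rather than `Wsup`; the two agree almost surely at
  -- each time and so have the same driver up to null sets.
  have hT := (hΦT Wsup).congr (hΦT Wsup).1 (hmeas Wsup.2.1) (hmeas hprog)
    (fun _ => EventuallyEq.rfl) fun s => by
      filter_upwards [heq s] with ω h1
      simp only [driver, h1]
  have hn := h.driver_nonneg hε hlo fun t => (hΦI Wsup t).mono fun ω h => h.1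
  refine ⟨Φ Wsup, ?_, hΦc Wsup, hΦ0 Wsup, lo, hi, hlo, hhi, hΦI Wsup⟩
  have hm := measurable_uncurry_of_progressive hprog
  exact hT.of_discount hc0 hm (measurable_uncurry_of_progressive
    (isStronglyProgressive_driver h.prog_U h.prog_a hprog))
    (fun t => Eventually.of_forall (hΦ0 Wsup t)) (fun t => (hn t).mono fun ω h => h.2)
    (h.lintegral_lt_top hm hhi.le fun t => (hΦI Wsup t).mono fun ω h => h.2)

/-- Comparison of fixed points works in any band, invariant or not, so two different bands can be
enlarged to a common one. -/
theorem fixedPoint_ae_eq [IsFiniteMeasure P] (h : Comparable 𝓕 P ρ a I U k K u₁ u₂)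
    (hε : 0 ≤ ε) {lo' hi' : ℝ} (hlo : 0 < lo) (hhi : 0 < hi) (hlo' : 0 < lo')
    (hW : IsStronglyProgressive 𝓕 W) (hV : IsStronglyProgressive 𝓕 V)
    (hWI : ∀ t, ∀ᵐ ω ∂P, lo * I t ω ≤ W t ω ∧ W t ω ≤ hi * I t ω)
    (hVI : ∀ t, ∀ᵐ ω ∂P, lo' * I t ω ≤ V t ω ∧ V t ω ≤ hi' * I t ω)
    (hWT : IsTail 𝓕 P W (driver ρ ε U a W)) (hVT : IsTail 𝓕 P V (driver ρ ε U a V)) (t : ℝ≥0) :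
    W t =ᵐ[P] V t := by
  have hlo₀ : 0 < min lo lo' := lt_min hlo hlo'
  have hhi₀ : 0 < max hi hi' := hhi.trans_le (le_max_left _ _)
  have hWI' : ∀ t, ∀ᵐ ω ∂P, min lo lo' * I t ω ≤ W t ω ∧ W t ω ≤ max hi hi' * I t ω := fun t => by
    filter_upwards [h.I_pos t, hWI t] with ω h1 h2
    exact ⟨le_trans (by gcongr; exact min_le_left _ _) h2.1,
      h2.2.trans (by gcongr; exact le_max_left _ _)⟩
  have hVI' : ∀ t, ∀ᵐ ω ∂P, min lo lo' * I t ω ≤ V t ω ∧ V t ω ≤ max hi hi' * I t ω := fun t => by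
    filter_upwards [h.I_pos t, hVI t] with ω h1 h2
    exact ⟨le_trans (by gcongr; exact min_le_right _ _) h2.1,
      h2.2.trans (by gcongr; exact le_max_right _ _)⟩
  filter_upwards [h.fixedPoint_le hε hlo₀ hhi₀ hW hV hWI' hVI' hWT hVT t,
    h.fixedPoint_le hε hlo₀ hhi₀ hV hW hVI' hWI' hVT hWT t] with ω h1 h2
  exact le_antisymm h1 h2

theorem lintegral_driver_lt_top [SFinite P] (h : Comparable 𝓕 P ρ a I U k K u₁ u₂)
    (hε : 0 ≤ ε) (hlo : 0 < lo) (hhi : 0 < hi) (hW : IsStronglyProgressive 𝓕 W)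
    (hWI : ∀ t, ∀ᵐ ω ∂P, lo * I t ω ≤ W t ω ∧ W t ω ≤ hi * I t ω) :
    ∫⁻ ω, ∫⁻ s, ENNReal.ofReal (driver ρ ε U a W s ω) ∂leb ∂P < ∞ := by
  have hM : 0 ≤ lo ^ ρ + hi ^ ρ := by positivity
  refine h.lintegral_lt_top (C := (lo ^ ρ + hi ^ ρ) * |u₂| + ε * K)
    (measurable_uncurry_of_progressive (isStronglyProgressive_driver h.prog_U h.prog_a hW))
    (add_nonneg (mul_nonneg hM (abs_nonneg _)) (mul_nonneg hε h.K_pos.le)) fun t => ?_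
  filter_upwards [h.ae_pos t, h.a_bound t, h.U_bound t, hWI t] with ω ⟨hI, _, hU⟩ h1 h2 h3
  have hIρ : 0 < I t ω ^ ρ := Real.rpow_pos_of_pos hI _
  -- Which edge of the band bounds `W ^ ρ` depends on the sign of `ρ`; the sum covers both cases.
  have hWρ : W t ω ^ ρ ≤ (lo ^ ρ + hi ^ ρ) * I t ω ^ ρ := by
    have hW0 : 0 < W t ω := (mul_pos hlo hI).trans_le h3.1
    have hl : 0 < lo ^ ρ * I t ω ^ ρ := by positivity
    have hh : 0 < hi ^ ρ * I t ω ^ ρ := by positivity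
    rw [add_mul]
    rcases le_or_gt 0 ρ with hρ | hρ
    · have := Real.rpow_le_rpow hW0.le h3.2 hρ
      rw [Real.mul_rpow hhi.le hI.le] at this
      linarith
    · have := Real.rpow_le_rpow_of_nonpos (mul_pos hlo hI) h3.1 hρ.le
      rw [Real.mul_rpow hlo.le hI.le] at this
      linarith
  have h4 : U t ω * W t ω ^ ρ ≤ (lo ^ ρ + hi ^ ρ) * |u₂| * I t ω :=
    calc U t ω * W t ω ^ ρ ≤ U t ω * ((lo ^ ρ + hi ^ ρ) * I t ω ^ ρ) := by gcongr
      _ = (lo ^ ρ + hi ^ ρ) * (U t ω * I t ω ^ ρ) := by ring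
      _ ≤ (lo ^ ρ + hi ^ ρ) * (u₂ * I t ω) := mul_le_mul_of_nonneg_left h2.2 hM
      _ ≤ (lo ^ ρ + hi ^ ρ) * (|u₂| * I t ω) := by gcongr; exact le_abs_self _
      _ = _ := by ring
  have h5 : ε * a t ω ≤ ε * (K * I t ω) := by gcongr; exact h1.2
  simp only [driver]
  linarith

theorem isTail_driver_iff [IsFiniteMeasure P] (h : Comparable 𝓕 P ρ a I U k K u₁ u₂)
    (hε : 0 ≤ ε) (hlo : 0 < lo) (hhi : 0 < hi) (hW : IsStronglyProgressive 𝓕 W)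
    (hWI : ∀ t, ∀ᵐ ω ∂P, lo * I t ω ≤ W t ω ∧ W t ω ≤ hi * I t ω) :
    IsTail 𝓕 P W (driver ρ ε U a W) ↔ ∀ t, W t =ᵐ[P] condTail 𝓕 P (driver ρ ε U a W) t := by
  have hn := h.driver_nonneg hε hlo fun t => (hWI t).mono fun ω h => h.1
  exact isTail_iff_condTail hW.stronglyAdapted (fun t => (hn t).mono fun ω h => h.1.le)
    (measurable_uncurry_of_progressive (isStronglyProgressive_driver h.prog_U h.prog_a hW))
    (fun t => (hn t).mono fun ω h => h.2) (h.lintegral_driver_lt_top hε hlo hhi hW hWI)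

end Comparable

/-! ### The Epstein–Zin operators -/

/-- The weight `U` has the order of `l`, hence of `I ^ (1 / θ)`, and `1 / θ + ρ = 1`. -/
theorem weight_bounds {θ ρ k K κ₁ κ₂ l I U : ℝ} (hθ : 0 < θ) (hρ : ρ = 1 - 1 / θ) (hI : 0 < I)
    (hl : 0 < l) (hk : 0 < k) (hK : 0 < K) (hκ₁ : 0 < κ₁) (hκ₂ : 0 < κ₂) (h1 : k * I ≤ l ^ θ)
    (h2 : l ^ θ ≤ K * I) (h3 : κ₁ * l ≤ U) (h4 : U ≤ κ₂ * l) :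
    κ₁ * k ^ (1 / θ) * I ≤ U * I ^ ρ ∧ U * I ^ ρ ≤ κ₂ * K ^ (1 / θ) * I := by
  have hθ' : 0 ≤ 1 / θ := by positivity
  have hl' : (l ^ θ) ^ (1 / θ) = l := by
    rw [← Real.rpow_mul hl.le, mul_one_div_cancel hθ.ne', Real.rpow_one]
  have hII : I ^ (1 / θ) * I ^ ρ = I := by
    rw [← Real.rpow_add hI, hρ, add_sub_cancel, Real.rpow_one]
  have h5 := Real.rpow_le_rpow (by positivity) h1 hθ'
  have h6 := Real.rpow_le_rpow (by positivity) h2 hθ'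
  rw [hl', Real.mul_rpow hk.le hI.le] at h5
  rw [hl', Real.mul_rpow hK.le hI.le] at h6
  have hIρ : 0 < I ^ ρ := Real.rpow_pos_of_pos hI _
  constructor
  · calc κ₁ * k ^ (1 / θ) * I = κ₁ * (k ^ (1 / θ) * I ^ (1 / θ)) * I ^ ρ := by
          nth_rewrite 1 [← hII]; ring
      _ ≤ κ₁ * l * I ^ ρ := by gcongr
      _ ≤ U * I ^ ρ := by gcongr
  · calc U * I ^ ρ ≤ κ₂ * l * I ^ ρ := by gcongr
      _ ≤ κ₂ * (K ^ (1 / θ) * I ^ (1 / θ)) * I ^ ρ := by gcongr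
      _ = κ₂ * K ^ (1 / θ) * I := by nth_rewrite 3 [← hII]; ring

theorem comparable_of_order [IsProbabilityMeasure P] {θ ρ k K κ₁ κ₂ : ℝ} (hθ : 0 < θ)
    (hρ : ρ = 1 - 1 / θ) {Λ U I : ℝ≥0 → Ω → ℝ} (hΛ : IsStronglyProgressive 𝓕 Λ)
    (hU : IsStronglyProgressive 𝓕 U) (hI : IsStronglyProgressive 𝓕 I)
    (hIT : IsTail 𝓕 P I (powProc Λ θ))
    (hfin : ∫⁻ ω, ∫⁻ s, ENNReal.ofReal (Λ s ω ^ θ) ∂leb ∂P < ∞) (hΛ0 : ∀ t, ∀ᵐ ω ∂P, 0 < Λ t ω)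
    (hk : 0 < k) (hK : 0 < K) (hκ₁ : 0 < κ₁) (hκ₂ : 0 < κ₂)
    (hb : ∀ t, ∀ᵐ ω ∂P, k * I t ω ≤ Λ t ω ^ θ ∧ Λ t ω ^ θ ≤ K * I t ω)
    (hUΛ : ∀ t, ∀ᵐ ω ∂P, κ₁ * Λ t ω ≤ U t ω ∧ U t ω ≤ κ₂ * Λ t ω) :
    Comparable 𝓕 P ρ (powProc Λ θ) I U k K (κ₁ * k ^ (1 / θ)) (κ₂ * K ^ (1 / θ)) where
  rho_lt := by
    have : 0 < 1 / θ := by positivity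
    linarith
  k_pos := hk
  K_pos := hK
  u₁_pos := mul_pos hκ₁ (Real.rpow_pos_of_pos hk _)
  prog_a := isStronglyProgressive_comp hΛ (measurable_id.pow_const θ)
  prog_I := hI
  prog_U := hU
  tail := hIT
  fin := hfin
  I_pos t := by
    filter_upwards [hΛ0 t, hb t] with ω h1 h2
    exact pos_of_mul_pos_right ((Real.rpow_pos_of_pos h1 θ).trans_le h2.2) hK.le
  a_bound := hb
  U_bound t := by
    filter_upwards [hΛ0 t, hb t, hUΛ t] with ω h1 h2 h3
    exact weight_bounds hθ hρ
      (pos_of_mul_pos_right ((Real.rpow_pos_of_pos h1 θ).trans_le h2.2) hK.le) h1 hk hK hκ₁ hκ₂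
      h2.1 h2.2 h3.1 h3.2

theorem hEZ_of_pos {ρ u w : ℝ} (hu : 0 < u) (hw : 0 < w) :
    hEZ ρ (ENNReal.ofReal u) (ENNReal.ofReal w) = ENNReal.ofReal (u * w ^ ρ) := by
  unfold hEZ
  rw [if_neg (by simp [hu]), if_neg (by simp [hw]), ENNReal.ofReal_rpow_of_pos hw,
    ← ENNReal.ofReal_mul hu.le]

theorem exists_unique_fixedPoint_orderClass [IsProbabilityMeasure P] (hUs : UsualConditions 𝓕 P)
    {θ ρ ε : ℝ} (hθ : 0 < θ) (hρ : ρ = 1 - 1 / θ) (hε : 0 ≤ ε) {Λ U : ℝ≥0 → Ω → ℝ}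
    (hΛ : Λ ∈ LThetaHat 𝓕 P θ) (hU : U ∈ OrderClass 𝓕 P Λ) :
    OrderClass 𝓕 P (powProc Λ θ) ⊆ IntegrableFor 𝓕 P ρ U ∧
      ∃ W ∈ OrderClass 𝓕 P (powProc Λ θ),
        IsFixedPoint 𝓕 P θ ρ ε U Λ W ∧
        (∀ ω, IsCadlag fun t => W t ω) ∧
        ∀ W' ∈ OrderClass 𝓕 P (powProc Λ θ),
          IsFixedPoint 𝓕 P θ ρ ε U Λ W' → Indistinguishable P W' W := by
  obtain ⟨⟨⟨hΛp, hΛ0⟩, hfin⟩, I₀, hI₀, ⟨_, k, K, hk, hK, hkK⟩⟩ := hΛ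
  obtain ⟨⟨hUp, _⟩, κ₁, κ₂, hκ₁, hκ₂, hUΛ⟩ := hU
  have hap : IsStronglyProgressive 𝓕 (powProc Λ θ) :=
    isStronglyProgressive_comp hΛp (measurable_id.pow_const θ)
  have ham := measurable_uncurry_of_progressive hap
  have ha0 : ∀ t, ∀ᵐ ω ∂P, 0 ≤ powProc Λ θ t ω := fun t =>
    hΛ0.mono fun ω h => (Real.rpow_pos_of_pos (h t) θ).le
  -- The given `I₀` is càdlàg only almost surely; this indistinguishable copy has all paths càdlàg
  -- and is therefore progressive.
  obtain ⟨I, hIT, hIc, hI0⟩ := exists_cadlag_isTail hUs hap hfin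
  have hIp := isStronglyProgressive_of_isCadlag hIT.1 hIc
  have hII : Indistinguishable P I I₀ := by
    refine indistinguishable_of_forall_ae (Eventually.of_forall hIc) hI₀.cadlag fun t => ?_
    exact ((isTail_iff_condTail hIT.1 (fun t => Eventually.of_forall (hI0 t)) ham ha0 hfin).1
      hIT t).trans (hI₀.version t).symm
  have hbd : ∀ᵐ ω ∂P, ∀ t, k * I t ω ≤ Λ t ω ^ θ ∧ Λ t ω ^ θ ≤ K * I t ω := by
    filter_upwards [hII, hkK] with ω h1 h2 t
    rw [h1 t]
    exact (h2 t).2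
  have hcomp := comparable_of_order hθ hρ hΛp hUp hIp hIT hfin
    (fun t => hΛ0.mono fun ω h => h t) hk hK hκ₁ hκ₂ (fun t => hbd.mono fun ω h => h t)
    fun t => hUΛ.mono fun ω h => (h t).2
  have horder : ∀ {X : ℝ≥0 → Ω → ℝ}, X ∈ OrderClass 𝓕 P (powProc Λ θ) → ∃ lo hi : ℝ, 0 < lo ∧
      0 < hi ∧ ∀ t, ∀ᵐ ω ∂P, lo * I t ω ≤ X t ω ∧ X t ω ≤ hi * I t ω := by
    rintro X ⟨_, k', K', hk', hK', hX⟩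
    refine ⟨k' * k, K' * K, mul_pos hk' hk, mul_pos hK' hK, fun t => ?_⟩
    filter_upwards [hbd, hX] with ω h1 h2
    rw [mul_assoc, mul_assoc]
    exact ⟨(mul_le_mul_of_nonneg_left (h1 t).1 hk'.le).trans (h2 t).2.1,
      (h2 t).2.2.trans (mul_le_mul_of_nonneg_left (h1 t).2 hK'.le)⟩
  refine ⟨fun X hX => ⟨hX.1, ?_⟩, ?_⟩
  · obtain ⟨lo, hi, hlo, hhi, hXI⟩ := horder hX
    obtain ⟨⟨hXp, _⟩, k', _, hk', _, hXΛ⟩ := hX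
    have h0 := hcomp.lintegral_driver_lt_top le_rfl hlo hhi hXp hXI
    refine lt_of_eq_of_lt (lintegral_congr_ae ?_) h0
    filter_upwards [hΛ0, hUΛ, hXΛ] with ω h1 h2 h3
    refine lintegral_congr fun s => ?_
    have hU0 : 0 < U s ω := (mul_pos hκ₁ (h1 s)).trans_le (h2 s).2.1
    have hX0 : 0 < X s ω :=
      (mul_pos hk' (Real.rpow_pos_of_pos (h1 s) θ)).trans_le (h3 s).2.1
    rw [hEZ_of_pos hU0 hX0]
    simp [driver]
  obtain ⟨W, hWT, hWc, hW0, lo, hi, hlo, hhi, hWI⟩ := hcomp.exists_fixedPoint hUs hε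
  have hWp := isStronglyProgressive_of_isCadlag hWT.1 hWc
  have hcI : ∀ (c : ℝ), ∀ᵐ ω ∂P, IsCadlag fun t => c * I t ω := fun c =>
    Eventually.of_forall fun ω => (isCadlag_of_continuous continuous_const).comp_continuous₂
      (hIc ω) (φ := fun x y => x * y) (x := fun _ => c) (by fun_prop)
  have hWc' : ∀ᵐ ω ∂P, IsCadlag fun t => W t ω := Eventually.of_forall hWc
  -- Membership in the order class needs one null set for all times; càdlàg paths of `W` and `I`
  -- provide it.
  have hlow := ae_forall_of_forall_ae (hcI lo) hWc' fun t => (hWI t).mono fun ω h => h.1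
  have hupp := ae_forall_of_forall_ae hWc' (hcI hi) fun t => (hWI t).mono fun ω h => h.2
  refine ⟨W, ⟨⟨hWp, Eventually.of_forall fun ω t => hW0 t ω⟩, lo / K, hi / k, div_pos hlo hK,
    div_pos hhi hk, ?_⟩, ⟨hWT.1, hWc', (hcomp.isTail_driver_iff hε hlo hhi hWp hWI).1 hWT⟩,
    hWc, fun W' hW' hfix => ?_⟩
  · filter_upwards [hΛ0, hbd, hlow, hupp] with ω h1 h2 h3 h4 t
    have h5 : 0 < powProc Λ θ t ω := Real.rpow_pos_of_pos (h1 t) θ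
    refine ⟨by positivity, ?_, ?_⟩
    · calc lo / K * powProc Λ θ t ω ≤ lo / K * (K * I t ω) := by gcongr; exact (h2 t).2
        _ = lo * I t ω := by field_simp
        _ ≤ _ := h3 t
    · calc W t ω ≤ hi * I t ω := h4 t
        _ = hi / k * (k * I t ω) := by field_simp
        _ ≤ _ := by gcongr; exact (h2 t).1
  · obtain ⟨lo', hi', hlo', hhi', hWI'⟩ := horder hW'
    have hWp' := hW'.1.1
    have hWT' := (hcomp.isTail_driver_iff hε hlo' hhi' hWp' hWI').2 hfix.version
    exact indistinguishable_of_forall_ae hfix.cadlag hWc'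
      (hcomp.fixedPoint_ae_eq hε hlo' hhi' hlo hWp' hWp hWI' hWI hWT' hWT)

/-! ### The Epstein–Zin utility process -/

theorem gEZ_eq_coe {b δ R S c v : ℝ} (hb : 0 < b) (hR : R ≠ 1) (hθ : 0 < (1 - R) / (1 - S))
    (t : ℝ≥0) (hc : 0 < c) (hv : 0 < (1 - R) * v) :
    gEZ b δ R S t c v = (((1 - R)⁻¹ * (b * ((1 - R) / (1 - S)) *
      (Real.exp (-δ * t) * c ^ (1 - S)) * ((1 - R) * v) ^ ((S - R) / (1 - R))) : ℝ) : EReal) := by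
  rw [gEZ_of_pos hb hR hθ t hc hv]
  have hR' : 1 - R ≠ 0 := sub_ne_zero.2 hR.symm
  congr 1
  field_simp

theorem isStronglyProgressive_const_mul {X : ℝ≥0 → Ω → ℝ} (hX : IsStronglyProgressive 𝓕 X)
    (c : ℝ) : IsStronglyProgressive 𝓕 fun t ω => c * X t ω :=
  isStronglyProgressive_comp hX (measurable_id.const_mul c)

/-- For a process `V` such that `(1 - R) V` is positive, the conditional tail integral of the
aggregator is a multiple of that of the driver. -/
theorem gEZ_driver [IsProbabilityMeasure P] {b δ R S : ℝ} (hb : 0 < b) (hR : R ≠ 1)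
    (hθ : 0 < (1 - R) / (1 - S)) {C V a : ℝ≥0 → Ω → ℝ} (hC : ∀ᵐ ω ∂P, ∀ t, 0 < C t ω)
    (hV : IsStronglyProgressive 𝓕 V) (hV0 : ∀ t, ∀ᵐ ω ∂P, 0 < (1 - R) * V t ω) :
    ∀ᵐ ω ∂P, ∀ᵐ s ∂leb, gEZ b δ R S s (C s ω) (V s ω) = (((1 - R)⁻¹ *
      driver ((S - R) / (1 - R)) 0 (fun s ω => b * ((1 - R) / (1 - S)) *
        (Real.exp (-δ * s) * C s ω ^ (1 - S))) a (fun s ω => (1 - R) * V s ω) s ω : ℝ) : EReal) := by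
  have h1 : ∀ᵐ ω ∂P, ∀ᵐ s ∂leb, 0 < (1 - R) * V s ω :=
    (Measure.ae_ae_comm (p := fun ω s => 0 < (1 - R) * V s ω) (measurableSet_lt measurable_const
      (((measurable_uncurry_of_progressive hV).comp measurable_swap).const_mul (1 - R)))).2
      (Eventually.of_forall hV0)
  filter_upwards [hC, h1] with ω h2 h3
  filter_upwards [h3] with s h4
  rw [gEZ_eq_coe hb hR hθ s (h2 s) h4]
  simp [driver]

/-- Linearity of conditional expectation after the substitution `W = (1 - R) V`. With `ε = 0` the
process `a` is immaterial. -/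
theorem condTail_gEZ [IsProbabilityMeasure P] {b δ R S : ℝ} (hb : 0 < b) (hR : R ≠ 1)
    (hθ : 0 < (1 - R) / (1 - S)) {C V : ℝ≥0 → Ω → ℝ} (a : ℝ≥0 → Ω → ℝ)
    (hC : ∀ᵐ ω ∂P, ∀ t, 0 < C t ω)
    (hV : IsStronglyProgressive 𝓕 V) (hV0 : ∀ t, ∀ᵐ ω ∂P, 0 < (1 - R) * V t ω) (t : ℝ≥0) :
    condTail 𝓕 P (fun s ω => (gEZ b δ R S s (C s ω) (V s ω)).toReal) t =ᵐ[P]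
      fun ω => (1 - R)⁻¹ * condTail 𝓕 P (driver ((S - R) / (1 - R)) 0
        (fun s ω => b * ((1 - R) / (1 - S)) * (Real.exp (-δ * s) * C s ω ^ (1 - S))) a
        (fun s ω => (1 - R) * V s ω)) t ω := by
  have h1 := condExp_smul (m := 𝓕 t) (μ := P) (1 - R)⁻¹ fun ω => ∫ s in Ioi t,
    driver ((S - R) / (1 - R)) 0 (fun s ω => b * ((1 - R) / (1 - S)) *
      (Real.exp (-δ * s) * C s ω ^ (1 - S))) a (fun s ω => (1 - R) * V s ω) s ω ∂leb
  refine EventuallyEq.trans (condExp_congr_ae ?_) h1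
  filter_upwards [gEZ_driver (a := a) hb hR hθ hC hV hV0] with ω h2
  rw [Pi.smul_apply, smul_eq_mul, ← integral_const_mul]
  refine integral_congr_ae (ae_restrict_of_ae ?_)
  filter_upwards [h2] with s h3
  exact (congrArg EReal.toReal h3).trans (EReal.toReal_coe _)

/-- Here `Λ ^ θ` is `exp (-δ θ s) C ^ (1 - R)`, because `(1 - S) θ = 1 - R`. The process `J` is an
arbitrary version of its tail, so its bounds are available only time by time; `Comparable` asks for
no more. -/
theorem exists_unique_utilityProcess [IsProbabilityMeasure P] (hUs : UsualConditions 𝓕 P)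
    {b δ R S : ℝ} (hb : 0 < b) (hR : R ≠ 1) (hS : S ≠ 1) (hθ : 0 < (1 - R) / (1 - S))
    {C J : ℝ≥0 → Ω → ℝ} (hC : C ∈ ProgPos 𝓕 P)
    (hfin : ∫⁻ ω, (∫⁻ s, ENNReal.ofReal (Real.exp (-δ * ((1 - R) / (1 - S)) * s) *
      C s ω ^ (1 - R)) ∂leb) ∂P < ∞)
    (hJ : J = condTail 𝓕 P (fun s ω => Real.exp (-δ * ((1 - R) / (1 - S)) * s) *
      C s ω ^ (1 - R))) {k K : ℝ} (hk : 0 < k) (hK : 0 < K)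
    (hCJ : ∀ t, ∀ᵐ ω ∂P,
      k * J t ω ≤ Real.exp (-δ * ((1 - R) / (1 - S)) * t) * C t ω ^ (1 - R) ∧
      Real.exp (-δ * ((1 - R) / (1 - S)) * t) * C t ω ^ (1 - R) ≤ K * J t ω) :
    ∃ V : ℝ≥0 → Ω → ℝ,
      IsUtilityProcess 𝓕 P (domEZ R) (gEZ b δ R S) C V ∧
      (∃ k K : ℝ, 0 < k ∧ 0 < K ∧ ∀ t, ∀ᵐ ω ∂P,
        k * J t ω ≤ (1 - R) * V t ω ∧ (1 - R) * V t ω ≤ K * J t ω) ∧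
      ∀ V' : ℝ≥0 → Ω → ℝ,
        IsUtilityProcess 𝓕 P (domEZ R) (gEZ b δ R S) C V' →
        (∃ k K : ℝ, 0 < k ∧ 0 < K ∧ ∀ t, ∀ᵐ ω ∂P,
          k * J t ω ≤ (1 - R) * V' t ω ∧ (1 - R) * V' t ω ≤ K * J t ω) →
        Indistinguishable P V' V := by
  obtain ⟨hCp, hC0⟩ := hC
  have hR' : 1 - R ≠ 0 := sub_ne_zero.2 hR.symm
  have hS' : 1 - S ≠ 0 := sub_ne_zero.2 hS.symm
  set θ := (1 - R) / (1 - S) with hθdef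
  set ρ := (S - R) / (1 - R) with hρdef
  have hρ : ρ = 1 - 1 / θ := by
    rw [hρdef, hθdef]
    field_simp
    ring
  set Λ : ℝ≥0 → Ω → ℝ := fun s ω => Real.exp (-δ * s) * C s ω ^ (1 - S) with hΛdef
  set U : ℝ≥0 → Ω → ℝ := fun s ω => b * θ * (Real.exp (-δ * s) * C s ω ^ (1 - S)) with hUdef
  have hΛp : IsStronglyProgressive 𝓕 Λ :=
    (isStronglyProgressive_time (measurable_exp_mul (-δ))).mul
      (isStronglyProgressive_comp hCp (measurable_id.pow_const (1 - S)))
  have hUp : IsStronglyProgressive 𝓕 U :=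
    isStronglyProgressive_const_mul hΛp (b * θ)
  have hΛθ : ∀ᵐ ω ∂P, ∀ s, 0 < Λ s ω ∧
      Λ s ω ^ θ = Real.exp (-δ * θ * s) * C s ω ^ (1 - R) := by
    filter_upwards [hC0] with ω h s
    have h1 := Real.rpow_pos_of_pos (h s) (1 - S)
    refine ⟨mul_pos (Real.exp_pos _) h1, ?_⟩
    simp only [hΛdef]
    rw [Real.mul_rpow (Real.exp_pos _).le h1.le, ← Real.exp_mul, ← Real.rpow_mul (h s).le]
    congr 2
    · ring
    · rw [hθdef]
      field_simp
  have hfin' : ∫⁻ ω, ∫⁻ s, ENNReal.ofReal (Λ s ω ^ θ) ∂leb ∂P < ∞ := by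
    refine lt_of_eq_of_lt (lintegral_congr_ae ?_) hfin
    filter_upwards [hΛθ] with ω h
    refine lintegral_congr fun s => ?_
    rw [(h s).2]
  have hap : IsStronglyProgressive 𝓕 (powProc Λ θ) :=
    isStronglyProgressive_comp hΛp (measurable_id.pow_const θ)
  have ham := measurable_uncurry_of_progressive hap
  have ha0 : ∀ t, ∀ᵐ ω ∂P, 0 ≤ powProc Λ θ t ω := fun t =>
    hΛθ.mono fun ω h => (Real.rpow_pos_of_pos (h t).1 θ).le
  obtain ⟨I, hIT, hIc, hI0⟩ := exists_cadlag_isTail hUs hap hfin'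
  have hIp := isStronglyProgressive_of_isCadlag hIT.1 hIc
  have hIJ : ∀ t, I t =ᵐ[P] J t := fun t => by
    refine ((isTail_iff_condTail hIT.1 (fun t => Eventually.of_forall (hI0 t)) ham ha0 hfin').1
      hIT t).trans ?_
    rw [hJ]
    refine condExp_congr_ae ?_
    filter_upwards [hΛθ] with ω h
    exact integral_congr_ae (Eventually.of_forall fun s => (h s).2)
  have hcomp : Comparable 𝓕 P ρ (powProc Λ θ) I U k K (b * θ * k ^ (1 / θ))
      (b * θ * K ^ (1 / θ)) := by
    refine comparable_of_order hθ hρ hΛp hUp hIp hIT hfin'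
      (fun t => hΛθ.mono fun ω h => (h t).1) hk hK (mul_pos hb hθ) (mul_pos hb hθ) (fun t => ?_)
      fun t => Eventually.of_forall fun ω => ⟨le_rfl, le_rfl⟩
    filter_upwards [hΛθ, hIJ t, hCJ t] with ω h1 h2 h3
    rw [(h1 t).2, h2]
    exact h3
  have hfix : ∀ {V : ℝ≥0 → Ω → ℝ} {lo hi : ℝ}, 0 < lo → 0 < hi → IsStronglyProgressive 𝓕 V →
      (∀ t, ∀ᵐ ω ∂P, lo * I t ω ≤ (1 - R) * V t ω ∧ (1 - R) * V t ω ≤ hi * I t ω) →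
      (IsTail 𝓕 P (fun t ω => (1 - R) * V t ω)
        (driver ρ 0 U (powProc Λ θ) fun t ω => (1 - R) * V t ω) ↔
      ∀ t, V t =ᵐ[P] condTail 𝓕 P (fun s ω => (gEZ b δ R S s (C s ω) (V s ω)).toReal) t) := by
    intro V lo hi hlo hhi hVp hVI
    have hV0 : ∀ t, ∀ᵐ ω ∂P, 0 < (1 - R) * V t ω := fun t => by
      filter_upwards [hcomp.I_pos t, hVI t] with ω h1 h2
      exact (mul_pos hlo h1).trans_le h2.1
    rw [hcomp.isTail_driver_iff le_rfl hlo hhi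
      (isStronglyProgressive_const_mul hVp (1 - R)) hVI]
    refine forall_congr' fun t => ?_
    have h1 := condTail_gEZ (𝓕 := 𝓕) (δ := δ) hb hR hθ (powProc Λ θ) hC0 hVp hV0 t
    constructor
    · intro h2
      filter_upwards [h1, h2] with ω h3 h4
      rw [h3]
      exact (eq_inv_mul_iff_mul_eq₀ hR').2 h4
    · intro h2
      filter_upwards [h1, h2] with ω h3 h4
      rw [h3] at h4
      exact (eq_inv_mul_iff_mul_eq₀ hR').1 h4
  obtain ⟨W, hWT, hWc, hW0, lo, hi, hlo, hhi, hWI⟩ := hcomp.exists_fixedPoint hUs le_rfl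
  have hWp := isStronglyProgressive_of_isCadlag hWT.1 hWc
  have hWV : ∀ t ω, (1 - R) * ((1 - R)⁻¹ * W t ω) = W t ω := fun t ω =>
    mul_inv_cancel_left₀ hR' _
  have hVp : IsStronglyProgressive 𝓕 fun t ω => (1 - R)⁻¹ * W t ω :=
    isStronglyProgressive_const_mul hWp _
  have hVI : ∀ t, ∀ᵐ ω ∂P, lo * I t ω ≤ (1 - R) * ((1 - R)⁻¹ * W t ω) ∧
      (1 - R) * ((1 - R)⁻¹ * W t ω) ≤ hi * I t ω := by
    simp_rw [hWV]
    exact hWI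
  have hVT : IsTail 𝓕 P (fun t ω => (1 - R) * ((1 - R)⁻¹ * W t ω))
      (driver ρ 0 U (powProc Λ θ) fun t ω => (1 - R) * ((1 - R)⁻¹ * W t ω)) := by
    simp_rw [hWV]
    exact hWT
  have hVc : ∀ ω, IsCadlag fun t => (1 - R)⁻¹ * W t ω := fun ω =>
    (isCadlag_of_continuous continuous_const).comp_continuous₂
      (hWc ω) (φ := fun x y => x * y) (x := fun _ => (1 - R)⁻¹) (by fun_prop)
  refine ⟨fun t ω => (1 - R)⁻¹ * W t ω, ⟨hVp, Eventually.of_forall fun ω t =>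
    -- The square of `(1 - R)⁻¹` makes the witness non-negative for either sign of `1 - R`.
    ⟨(1 - R)⁻¹ * (1 - R)⁻¹ * W t ω, mul_nonneg (mul_self_nonneg _) (hW0 t ω), ?_⟩, ?_,
    Eventually.of_forall hVc, (hfix hlo hhi hVp hVI).1 hVT⟩, ⟨lo, hi, hlo, hhi, fun t => ?_⟩, ?_⟩
  · rw [mul_assoc, mul_inv_cancel_left₀ hR']
  · have hdf := hcomp.lintegral_driver_lt_top le_rfl hlo hhi
      (isStronglyProgressive_const_mul hVp (1 - R)) hVI
    have hV0 : ∀ t, ∀ᵐ ω ∂P, 0 < (1 - R) * ((1 - R)⁻¹ * W t ω) := fun t => by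
      filter_upwards [hcomp.I_pos t, hVI t] with ω h1 h2
      exact (mul_pos hlo h1).trans_le h2.1
    have hdn := hcomp.driver_nonneg (ε := 0) le_rfl hlo fun t => (hVI t).mono fun ω h => h.1
    have hdm := measurable_uncurry_of_progressive (isStronglyProgressive_driver (ρ := ρ) (ε := 0)
      hUp hap (isStronglyProgressive_const_mul hVp (1 - R)))
    have hdn' : ∀ᵐ ω ∂P, ∀ᵐ s ∂leb, 0 ≤ driver ρ 0 U (powProc Λ θ)
        (fun t ω => (1 - R) * ((1 - R)⁻¹ * W t ω)) s ω :=
      (Measure.ae_ae_comm (p := fun ω s => 0 ≤ driver ρ 0 U (powProc Λ θ)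
        (fun t ω => (1 - R) * ((1 - R)⁻¹ * W t ω)) s ω)
        (measurableSet_le measurable_const (hdm.comp measurable_swap))).2
        (Eventually.of_forall fun t => (hdn t).mono fun ω h => h.2)
    have habs : ∫⁻ ω, ∫⁻ s, (gEZ b δ R S s (C s ω) ((1 - R)⁻¹ * W s ω)).abs ∂leb ∂P =
        ∫⁻ ω, ENNReal.ofReal |(1 - R)⁻¹| * ∫⁻ s, ENNReal.ofReal (driver ρ 0 U (powProc Λ θ)
          (fun t ω => (1 - R) * ((1 - R)⁻¹ * W t ω)) s ω) ∂leb ∂P := by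
      refine lintegral_congr_ae ?_
      filter_upwards [gEZ_driver (δ := δ) (a := powProc Λ θ) hb hR hθ hC0 hVp hV0, hdn']
        with ω h1 h2
      rw [← lintegral_const_mul _ (measurable_section (measurable_uncurry_ofReal hdm) ω)]
      refine lintegral_congr_ae ?_
      filter_upwards [h1, h2] with s h3 h4
      rw [h3, EReal.abs_def, abs_mul, abs_of_nonneg h4, ENNReal.ofReal_mul (abs_nonneg _)]
    have hdm' := measurable_lintegral_section hdm univ
    simp only [Measure.restrict_univ] at hdm'
    rw [habs, lintegral_const_mul _ hdm']
    exact ENNReal.mul_lt_top ENNReal.ofReal_lt_top hdf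
  · filter_upwards [hVI t, hIJ t] with ω h1 h2
    rw [← h2]
    exact h1
  · rintro V' hV' ⟨lo', hi', hlo', hhi', hVJ'⟩
    have hVI' : ∀ t, ∀ᵐ ω ∂P, lo' * I t ω ≤ (1 - R) * V' t ω ∧
        (1 - R) * V' t ω ≤ hi' * I t ω := fun t => by
      filter_upwards [hVJ' t, hIJ t] with ω h1 h2
      rw [h2]
      exact h1
    have hVT' := (hfix hlo' hhi' hV'.prog hVI').2 hV'.eq
    have heq := hcomp.fixedPoint_ae_eq le_rfl hlo' hhi' hlo
      (isStronglyProgressive_const_mul hV'.prog (1 - R))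
      (isStronglyProgressive_const_mul hVp (1 - R)) hVI' hVI hVT' hVT
    refine indistinguishable_of_forall_ae hV'.cadlag (Eventually.of_forall hVc) fun t => ?_
    filter_upwards [heq t] with ω h
    exact mul_left_cancel₀ hR' h

end EZ

/-! ### The main theorem -/

theorem mainTheorem6 {Ω : Type*} {m : MeasurableSpace Ω} (P : Measure Ω) [IsProbabilityMeasure P]
    (𝓕 : Filtration ℝ≥0 m) (hUsual : EZ.UsualConditions 𝓕 P)
    (hTrivial : ∀ A : Set Ω, MeasurableSet[𝓕 0] A → P A = 0 ∨ P A = 1)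
    (b δ R S θ ρ : ℝ) (hb : 0 < b) (hR : 0 < R) (hR1 : R ≠ 1) (hS : 0 < S) (hS1 : S ≠ 1)
    (hRS : R ≠ S) (hθ : θ = (1 - R) / (1 - S)) (hθpos : 0 < θ) (hρ : ρ = (S - R) / (1 - R)) :
    -- the fixed point of the perturbed operator
    (∀ ε : ℝ, 0 ≤ ε → ∀ Λ ∈ EZ.LThetaHat 𝓕 P θ, ∀ U ∈ EZ.OrderClass 𝓕 P Λ,
      EZ.OrderClass 𝓕 P (EZ.powProc Λ θ) ⊆ EZ.IntegrableFor 𝓕 P ρ U ∧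
      ∃ W ∈ EZ.OrderClass 𝓕 P (EZ.powProc Λ θ),
        EZ.IsFixedPoint 𝓕 P θ ρ ε U Λ W ∧
        (∀ ω, EZ.IsCadlag fun t => W t ω) ∧
        ∀ W' ∈ EZ.OrderClass 𝓕 P (EZ.powProc Λ θ),
          EZ.IsFixedPoint 𝓕 P θ ρ ε U Λ W' → EZ.Indistinguishable P W' W) ∧
    -- the Epstein–Zin utility process
    (∀ C ∈ EZ.ProgPos 𝓕 P,
      ∫⁻ ω, (∫⁻ s, ENNReal.ofReal (Real.exp (-δ * θ * s) * C s ω ^ (1 - R)) ∂EZ.leb) ∂P < ∞ →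
      ∀ J : ℝ≥0 → Ω → ℝ,
      J = EZ.condTail 𝓕 P (fun s ω => Real.exp (-δ * θ * s) * C s ω ^ (1 - R)) →
      (∃ k K : ℝ, 0 < k ∧ k < K ∧ ∀ t, ∀ᵐ ω ∂P,
        k * J t ω ≤ Real.exp (-δ * θ * t) * C t ω ^ (1 - R) ∧
        Real.exp (-δ * θ * t) * C t ω ^ (1 - R) ≤ K * J t ω) →
      ∃ V : ℝ≥0 → Ω → ℝ,
        EZ.IsUtilityProcess 𝓕 P (EZ.domEZ R) (EZ.gEZ b δ R S) C V ∧
        (∃ k K : ℝ, 0 < k ∧ 0 < K ∧ ∀ t, ∀ᵐ ω ∂P,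
          k * J t ω ≤ (1 - R) * V t ω ∧ (1 - R) * V t ω ≤ K * J t ω) ∧
        ∀ V' : ℝ≥0 → Ω → ℝ,
          EZ.IsUtilityProcess 𝓕 P (EZ.domEZ R) (EZ.gEZ b δ R S) C V' →
          (∃ k K : ℝ, 0 < k ∧ 0 < K ∧ ∀ t, ∀ᵐ ω ∂P,
            k * J t ω ≤ (1 - R) * V' t ω ∧ (1 - R) * V' t ω ≤ K * J t ω) →
          EZ.Indistinguishable P V' V) := by
  subst hθ
  have hθ' : ρ = 1 - 1 / ((1 - R) / (1 - S)) := by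
    have h1 : 1 - R ≠ 0 := sub_ne_zero.2 hR1.symm
    have h2 : 1 - S ≠ 0 := sub_ne_zero.2 hS1.symm
    rw [hρ]
    field_simp
    ring
  refine ⟨fun ε hε Λ hΛ U hU =>
    EZ.exists_unique_fixedPoint_orderClass hUsual hθpos hθ' hε hΛ hU, ?_⟩
  rintro C hC hfin J hJ ⟨k, K, hk, hkK, hCJ⟩
  exact EZ.exists_unique_utilityProcess hUsual hb hR1 hS1 hθpos hC hfin hJ hk (hk.trans hkK) hCJ
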